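/- For a Weierstrass curve $E: y^2+a_1xy+a_3y=x^3+a_2x^2+a_4x+a_6$ over $\mathbb{Q}$ and a point $P=(x,y)\in E(\mathbb Q)$ with $2P\neq\mathcal O$, let $\psi_n=\psi_n(P)$ be the value at $P$ of the $n$-th division polynomial, $\phi_n=x\psi_n^2-\psi_{n+1}\psi_{n-1}$, and let $\omega_n$ be given by $\omega_0=1$, $\omega_1=y$ and $$\omega_n=\frac{\psi_{n-1}^2\psi_{n+2}-\psi_{n-2}\psi_{n+1}^2-\psi_2\psi_n\,(a_1\phi_n+a_3\psi_n^2)}{2\psi_2}\qquad(n\ge 2),$$ so that $[n]P=(\phi_n/\psi_n^2,\ \omega_n/\psi_n^3)$ when $[n]P\ne\mathcal O$. For an integer $\alpha$ put $$\beta=(2\alpha-1)(\alpha-1),\quad \zeta=-\alpha^2+3\alpha-1,\quad \lambda=(3\alpha^2-3\alpha+1)(\alpha-2\alpha^2),\quad \theta=2\alpha-2\alpha^2-1,\quad \eta=\alpha^2-\alpha+1.$$ For $N\in\{4,5,6,7,9\}$ let $E_N$ be the Tate normal form $y^2+(1-c)xy-by=x^3-bx^2$ with - $N=4$: $b=\alpha$,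 $c=0$; - $N=5$: $b=c=\alpha$; - $N=6$: $b=\alpha+\alpha^2$, $c=\alpha$; - $N=7$: $b=\alpha^3-\alpha^2$, $c=\alpha^2-\alpha$; - $N=9$: $c=\alpha^2(\alpha-1)$, $b=c(\alpha(\alpha-1)+1)$; and let $E_{10}$, $E_{12}$ be the integral models of the Tate normal forms $$E_{10}: y^2+(\zeta^2-\alpha\beta\zeta)xy-\alpha^3\beta\zeta^4y=x^3-\alpha^3\beta\zeta^2x^2,$$ $$E_{12}: y^2+(\alpha-1)((\alpha-1)^3-\lambda)xy-(\alpha-1)^8\lambda\theta y=x^3-(\alpha-1)^4\lambda\theta x^2.$$ Assume $\alpha\neq0$; for $N=6$ also $\alpha\ne-1$; for $N=7,9,10,12$ also $\alpha\neq1$. Let $P=(0,0)$ and $H_n=\omega_n(P)$ on $E_N$. **Theorem A.2.** For all integers $n\ge0$ the following formulas hold. In them all exponents are non-negative integers, $n\equiv r\ (m)$ means congruence modulo $m$, and $\varepsilon=+1$ for $n$ in the first listed classes and $\varepsilon=-1$ for $n$ in the second. 1. $N=4$: $H_n=0$ if $n\equiv1,2\ (4)$; otherwise $H_n=\varepsilon\,\alpha^{(9n^2-a)/8}$,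 where $\varepsilon=+1$ for $n\equiv0\ (8)$ and $-1$ for $n\equiv3,4,7\ (8)$; $a=0,1$ for $n\equiv0,3\ (4)$ respectively. 2. $N=5$: $H_n=0$ if $n\equiv1,3\ (5)$; otherwise $H_n=\varepsilon\,\alpha^{(6n^2-a)/5}$, where $\varepsilon=+1$ for $n\equiv0,4,7\ (10)$ and $-1$ for $n\equiv2,5,9\ (10)$; $a=0,-1,1$ for $n\equiv0,2,4\ (5)$ respectively. 3. $N=6$: $H_n=0$ if $n\equiv1,4\ (6)$; otherwise $H_n=\varepsilon\,\alpha^{(5n^2-a)/4}(\alpha+1)^{n^2}$, where $\varepsilon=+1$ for $n\equiv0,5,6,9\ (12)$ and $-1$ for $n\equiv2,3,8,11\ (12)$; $a=0,0,1,1$ for $n\equiv0,2,3,5\ (6)$ respectively. 4. $N=7$: $H_n=0$ if $n\equiv1,5\ (7)$; otherwise $H_n=\varepsilon\,\alpha^{(15n^2-a)/7}(\alpha-1)^{(9n^2-b)/7}$, where $\varepsilon=+1$ for $n\equiv0,4,7,11\ (14)$ and $-1$ for $n\equiv2,3,6,9,10,13\ (14)$; for $n\equiv0,2,3,4,6\ (7)$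 respectively, $a=0,-3,2,-5,1$ and $b=0,1,4,4,2$. 5. $N=9$: $H_n=0$ if $n\equiv1,7\ (9)$; otherwise $H_n=\varepsilon\,\alpha^{(7n^2+a)/3}(\alpha-1)^{(4n^2-b)/3}\eta^{n^2+c}$, where $\varepsilon=+1$ for $n\equiv0,4,5,8,11,12,15\ (18)$ and $-1$ for $n\equiv2,3,6,9,13,14,17\ (18)$; for $n\equiv0,2,3,4,5,6,8\ (9)$ respectively, $a=0,2,0,-1,2,3,-1$, $b=0,1,3,4,4,3,1$ and $c=0,0,0,1,0,0,0$. 6. $N=10$: $H_n=0$ if $n\equiv1,8\ (10)$; otherwise $H_n=\varepsilon\,\alpha^{(63n^2+a)/20}(\alpha-1)^{(27n^2-b)/20}(2\alpha-1)^{(6n^2+c)/5}\zeta^{(15n^2+d)/4}$, where $\varepsilon=+1$ for $n\equiv0,4,5,9,10,13,14,17\ (20)$ and $-1$ for $n\equiv2,3,6,7,12,15,16,19\ (20)$; for $n\equiv0,2,3,4,5,6,7,9\ (10)$ respectively, $a=0,8,-7,32,25,-8,13,-3$, $b=0,8,23,32,35,32,23,7$, $c=0,1,1,-1,0,4,1,-1$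 and $d=0,0,1,0,1,0,1,1$. 7. $N=12$: $H_n=0$ if $n\equiv1,10\ (12)$; otherwise $H_n=\varepsilon\,\alpha^{(n^2-a)/4}(\alpha-1)^{(59n^2+b)/8}(2\alpha-1)^{(n^2-c)/8}\lambda^{(9n^2-d)/8}\theta^{n^2+e}$, where $\varepsilon=+1$ for $n\equiv0,3,5,7,8,11,14,16,18,21\ (24)$ and $-1$ for $n\equiv2,4,6,9,12,15,17,19,20,23\ (24)$; for $n\equiv0,2,3,4,5,6,7,8,9,11\ (12)$ respectively, $a=0,4,5,8,13,12,9,8,9,1$, $b=0,-4,13,0,5,12,-3,16,-3,5$, $c=0,4,1,0,9,4,-7,0,9,1$, $d=0,-4,1,0,-7,-4,1,0,-7,1$ and $e=0,0,0,1,0,0,1,0,0,0$. -/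

import Mathlib

/-!
Values of division polynomials at a point, and the Tate normal forms with their integral models.
-/

namespace TateNormalForm

/-- The value `ψₙ(P)` of the `n`-th division polynomial of `W` at `P = (x, y)`. -/
noncomputable def psiAt {K : Type*} [Field K] (W : WeierstrassCurve K) (x y : K) (n : ℤ) : K :=
  (W.ψ n).evalEval x y

/-- The value `φₙ(P)` of the polynomial `φₙ = X ψₙ² - ψₙ₊₁ ψₙ₋₁` at `P = (x, y)`:
the numerator of the `x`-coordinate of `[n]P`. -/
noncomputable def phiAt {K : Type*} [Field K] (W : WeierstrassCurve K) (x y : K) (n : ℤ) : K :=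
  (W.φ n).evalEval x y

/-- The value `ωₙ(P)` at `P = (x, y)`, the numerator of the `y`-coordinate
`ωₙ(P) / ψₙ(P) ^ 3` of `[n]P`: `ω₀ = 1`, `ω₁ = y` and
`2 ψ₂ ωₙ = ψₙ₋₁² ψₙ₊₂ - ψₙ₋₂ ψₙ₊₁² - ψ₂ ψₙ (a₁ φₙ + a₃ ψₙ²)` for `n ≥ 2`.
It is meaningful when the characteristic is not two and `P` is not a two-torsion point
(so that `ψ₂(P) ≠ 0`). -/
noncomputable def omegaAt {K : Type*} [Field K] (W : WeierstrassCurve K) (x y : K) : ℕ → K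
  | 0 => 1
  | 1 => y
  | n@(_ + 2) =>
    (psiAt W x y ((n : ℤ) - 1) ^ 2 * psiAt W x y ((n : ℤ) + 2)
        - psiAt W x y ((n : ℤ) - 2) * psiAt W x y ((n : ℤ) + 1) ^ 2
        - psiAt W x y 2 * psiAt W x y n
          * (W.a₁ * phiAt W x y n + W.a₃ * psiAt W x y n ^ 2))
      / (2 * psiAt W x y 2)

/-- The sequence `Hₙ = ωₙ(P)` for the point `P = (0, 0)`. -/
noncomputable def H (W : WeierstrassCurve ℚ) (n : ℕ) : ℚ := omegaAt W 0 0 n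

/-- The Tate normal form `y² + (1 - c) x y - b y = x³ - b x²`. -/
def tate (b c : ℚ) : WeierstrassCurve ℚ := ⟨1 - c, -b, -b, 0, 0⟩

def E4 (α : ℚ) : WeierstrassCurve ℚ := tate α 0

def E5 (α : ℚ) : WeierstrassCurve ℚ := tate α α

def E6 (α : ℚ) : WeierstrassCurve ℚ := tate (α + α ^ 2) α

def E7 (α : ℚ) : WeierstrassCurve ℚ := tate (α ^ 3 - α ^ 2) (α ^ 2 - α)

/-- `c = α² (α - 1)` and `b = c (α (α - 1) + 1)`. -/
def E9 (α : ℚ) : WeierstrassCurve ℚ :=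
  tate (α ^ 2 * (α - 1) * (α * (α - 1) + 1)) (α ^ 2 * (α - 1))

def eta (α : ℚ) : ℚ := α ^ 2 - α + 1

def beta (α : ℚ) : ℚ := (2 * α - 1) * (α - 1)

def zeta (α : ℚ) : ℚ := -α ^ 2 + 3 * α - 1

def lam (α : ℚ) : ℚ := (3 * α ^ 2 - 3 * α + 1) * (α - 2 * α ^ 2)

def theta (α : ℚ) : ℚ := 2 * α - 2 * α ^ 2 - 1

/-- The integral model
`y² + (ζ² - α β ζ) x y - α³ β ζ⁴ y = x³ - α³ β ζ² x²` of the Tate normal form with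
`c = α β / ζ` and `b = c α² / ζ`. -/
def E10 (α : ℚ) : WeierstrassCurve ℚ :=
  ⟨zeta α ^ 2 - α * beta α * zeta α, -(α ^ 3 * beta α * zeta α ^ 2),
    -(α ^ 3 * beta α * zeta α ^ 4), 0, 0⟩

/-- The integral model
`y² + (α - 1) ((α - 1)³ - λ) x y - (α - 1)⁸ λ θ y = x³ - (α - 1)⁴ λ θ x²` of the Tate normal
form with `c = λ / (α - 1)³` and `b = c θ / (α - 1)`. -/
def E12 (α : ℚ) : WeierstrassCurve ℚ :=
  ⟨(α - 1) * ((α - 1) ^ 3 - lam α), -((α - 1) ^ 4 * lam α * theta α),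
    -((α - 1) ^ 8 * lam α * theta α), 0, 0⟩

/-!
The signs and the corrections in the exponents. For the torsion order `N` the sign depends on
`n` modulo `2 N` and each correction on `n` modulo `N`. They are used only for those `n` whose
residue class is not one of the two on which `H` vanishes; there a default value is given.
-/

def eps4 (n : ℕ) : ℤ :=
  match n % 8 with
  | 0 => 1
  | 3 | 4 | 7 => -1
  | _ => 0

def a4 (n : ℕ) : ℤ :=
  match n % 4 with
  | 0 => 0
  | 3 => 1
  | _ => 0

def eps5 (n : ℕ) : ℤ :=
  match n % 10 with
  | 0 | 4 | 7 => 1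
  | 2 | 5 | 9 => -1
  | _ => 0

def a5 (n : ℕ) : ℤ :=
  match n % 5 with
  | 0 => 0
  | 2 => -1
  | 4 => 1
  | _ => 0

def eps6 (n : ℕ) : ℤ :=
  match n % 12 with
  | 0 | 5 | 6 | 9 => 1
  | 2 | 3 | 8 | 11 => -1
  | _ => 0

def a6 (n : ℕ) : ℤ :=
  match n % 6 with
  | 0 | 2 => 0
  | 3 | 5 => 1
  | _ => 0

def eps7 (n : ℕ) : ℤ :=
  match n % 14 with
  | 0 | 4 | 7 | 11 => 1
  | 2 | 3 | 6 | 9 | 10 | 13 => -1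
  | _ => 0

def a7 (n : ℕ) : ℤ :=
  match n % 7 with
  | 0 => 0
  | 2 => -3
  | 3 => 2
  | 4 => -5
  | 6 => 1
  | _ => 0

def b7 (n : ℕ) : ℤ :=
  match n % 7 with
  | 0 => 0
  | 2 => 1
  | 3 | 4 => 4
  | 6 => 2
  | _ => 0

def eps9 (n : ℕ) : ℤ :=
  match n % 18 with
  | 0 | 4 | 5 | 8 | 11 | 12 | 15 => 1
  | 2 | 3 | 6 | 9 | 13 | 14 | 17 => -1
  | _ => 0

def a9 (n : ℕ) : ℤ :=
  match n % 9 with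
  | 0 | 3 => 0
  | 2 | 5 => 2
  | 4 | 8 => -1
  | 6 => 3
  | _ => 0

def b9 (n : ℕ) : ℤ :=
  match n % 9 with
  | 0 => 0
  | 2 | 8 => 1
  | 3 | 6 => 3
  | 4 | 5 => 4
  | _ => 0

def c9 (n : ℕ) : ℤ :=
  match n % 9 with
  | 0 | 2 | 3 | 5 | 6 | 8 => 0
  | 4 => 1
  | _ => 0

def eps10 (n : ℕ) : ℤ :=
  match n % 20 with
  | 0 | 4 | 5 | 9 | 10 | 13 | 14 | 17 => 1
  | 2 | 3 | 6 | 7 | 12 | 15 | 16 | 19 => -1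
  | _ => 0

def a10 (n : ℕ) : ℤ :=
  match n % 10 with
  | 0 => 0
  | 2 => 8
  | 3 => -7
  | 4 => 32
  | 5 => 25
  | 6 => -8
  | 7 => 13
  | 9 => -3
  | _ => 0

def b10 (n : ℕ) : ℤ :=
  match n % 10 with
  | 0 => 0
  | 2 => 8
  | 3 | 7 => 23
  | 4 | 6 => 32
  | 5 => 35
  | 9 => 7
  | _ => 0

def c10 (n : ℕ) : ℤ :=
  match n % 10 with
  | 0 | 5 => 0
  | 2 | 3 | 7 => 1
  | 4 | 9 => -1
  | 6 => 4
  | _ => 0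

def d10 (n : ℕ) : ℤ :=
  match n % 10 with
  | 0 | 2 | 4 | 6 => 0
  | 3 | 5 | 7 | 9 => 1
  | _ => 0

def eps12 (n : ℕ) : ℤ :=
  match n % 24 with
  | 0 | 3 | 5 | 7 | 8 | 11 | 14 | 16 | 18 | 21 => 1
  | 2 | 4 | 6 | 9 | 12 | 15 | 17 | 19 | 20 | 23 => -1
  | _ => 0

def a12 (n : ℕ) : ℤ :=
  match n % 12 with
  | 0 => 0
  | 2 => 4
  | 3 => 5
  | 4 | 8 => 8
  | 5 => 13
  | 6 => 12
  | 7 | 9 => 9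
  | 11 => 1
  | _ => 0

def b12 (n : ℕ) : ℤ :=
  match n % 12 with
  | 0 | 4 => 0
  | 2 => -4
  | 3 => 13
  | 5 | 11 => 5
  | 6 => 12
  | 7 | 9 => -3
  | 8 => 16
  | _ => 0

def c12 (n : ℕ) : ℤ :=
  match n % 12 with
  | 0 | 4 | 8 => 0
  | 2 | 6 => 4
  | 3 | 11 => 1
  | 5 | 9 => 9
  | 7 => -7
  | _ => 0

def d12 (n : ℕ) : ℤ :=
  match n % 12 with
  | 0 | 4 | 8 => 0
  | 2 | 6 => -4
  | 3 | 7 | 11 => 1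
  | 5 | 9 => -7
  | _ => 0

def e12 (n : ℕ) : ℤ :=
  match n % 12 with
  | 0 | 2 | 3 | 5 | 6 | 8 | 9 | 11 => 0
  | 4 | 7 => 1
  | _ => 0

end TateNormalForm

/-! Write ψ(n) for the value of the n-th division polynomial at P = (0, 0). As N kills P, the
sequence ψ is quasi-periodic: ψ(n + N) = u v^n ψ(n) for constants u, v. Hence u, v and finitely many
values determine ψ, and on E_N all of these are, up to sign, monomials in a few factors such as α, α
- 1, ζ, θ.

The proof runs this backwards. A table of values, together with u and v, is extended to an odd
quasi-periodic sequence on ℤ. The duplication recurrences of ψ are compatible with translation by N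
and with reflection, so they need checking only for 2m ≤ N (`IsQuasiPeriodic.even_rel`,
`IsQuasiPeriodic.odd_rel`). Since ψ(2) ≠ 0 these recurrences determine ψ, so the extension is ψ
(`TorsionData.psiAt_eq`).

A third relation, checked in the same way, collapses the definition of ω to ψ(2) ω(n) = ψ(n-1)²
ψ(n+2) (`TorsionData.H_mul_eq`). This explains the vanishing classes n ≡ 1 and n ≡ -2 mod N, and
gives H(n + N) = u³ v^(3n) H(n) (`TorsionData.H_add`). The exponents therefore grow by amounts
linear in n, which sum to the quadratic formulas; the corrections record the first N values and the
sign rule comes from the signs of u and v. -/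

namespace TateNormalForm

/-! ### Quasi-periodic odd sequences and the elliptic divisibility recurrences. -/

section QuasiPeriodic

variable {K : Type*} [Field K]

/-- A property of integers that is invariant under the translation by `N` and under the reflection
`m ↦ -m - j`, where `j ≤ 1`, holds everywhere as soon as it holds on `[0, N / 2]`. -/
theorem forall_int_of_add_of_neg {P : ℤ → Prop} {N : ℕ} (hN : 0 < N) {j : ℤ} (hj0 : 0 ≤ j)
    (hj1 : j ≤ 1) (hadd : ∀ m, P (m + N) ↔ P m) (hneg : ∀ m, P m → P (-m - j))
    (h : ∀ m : ℕ, 2 * m ≤ N → P m) (m : ℤ) : P m := by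
  have hmul : ∀ q : ℤ, ∀ m, P (m + N * q) ↔ P m := by
    intro q
    induction q with
    | zero => simp
    | succ q ih => intro m; rw [mul_add, mul_one, ← add_assoc, hadd, ih]
    | pred q ih =>
      intro m
      rw [← hadd, show m + N * (-(q : ℤ) - 1) + N = m + N * -q by ring, ih]
  have hN' : (0 : ℤ) < N := by exact_mod_cast hN
  rw [← Int.emod_add_mul_ediv m N, hmul]
  have h0 := Int.emod_nonneg m hN'.ne'
  have h1 := Int.emod_lt_of_pos m hN'
  generalize m % N = r at h0 h1 ⊢
  rcases le_or_gt (2 * r) N with hr | hr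
  · lift r to ℕ using h0
    exact h r (by exact_mod_cast hr)
  -- Modulo N the residue r is the reflection of s = N - j - r, and 2r > N puts s in the lower half.
  · obtain ⟨s, hs⟩ := Int.eq_ofNat_of_zero_le (show 0 ≤ N - j - r by omega)
    have := hneg _ (h s (by omega))
    rwa [← hs, show -(N - j - r) - j = r + N * (-1) by ring, hmul] at this

/-- An odd sequence over the integers that is multiplied by `u * v ^ n` under the translation
of the argument `n` by `N`. -/
structure IsQuasiPeriodic (F : ℤ → K) (N : ℕ) (u v : K) : Prop where
  u_ne_zero : u ≠ 0
  v_ne_zero : v ≠ 0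
  sq_eq : u ^ 2 = v ^ N
  add_eq : ∀ n, F (n + N) = u * v ^ n * F n
  neg_eq : ∀ n, F (-n) = -F n

namespace IsQuasiPeriodic

variable {F : ℤ → K} {N : ℕ} {u v : K}

/-- Two translations contribute u² v^(4m + 2k + N), and u² = v^N turns this into u⁴ v^(4m + 2k).
This is the scaling of a product of four terms with index near m. -/
theorem two_mul_add (hF : IsQuasiPeriodic F N u v) (m k : ℤ) :
    F (2 * (m + N) + k) = u ^ 4 * (v ^ m) ^ 4 * v ^ (2 * k) * F (2 * m + k) := by
  have hv := hF.v_ne_zero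
  rw [show 2 * (m + N) + k = 2 * m + k + N + N by ring, hF.add_eq, hF.add_eq,
    zpow_add₀ hv (2 * m + k) N, zpow_natCast, ← hF.sq_eq, mul_comm 2 k, zpow_add₀ hv, mul_comm 2 m,
    zpow_mul, zpow_mul]
  simp only [zpow_ofNat]
  ring

theorem add_add (hF : IsQuasiPeriodic F N u v) (m k : ℤ) :
    F (m + N + k) = u * v ^ m * v ^ k * F (m + k) := by
  rw [add_right_comm, hF.add_eq, zpow_add₀ hF.v_ne_zero, ← mul_assoc]

theorem add_sub (hF : IsQuasiPeriodic F N u v) (m k : ℤ) :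
    F (m + N - k) = u * v ^ m * (v ^ k)⁻¹ * F (m - k) := by
  rw [sub_eq_add_neg, hF.add_add, zpow_neg, ← sub_eq_add_neg]

/-- Each product on the right has degree four and index offsets from m summing to 0, so translation
scales both sides by u⁴ v^(4m). -/
theorem even_rel (hF : IsQuasiPeriodic F N u v) (hN : 0 < N)
    (h : ∀ m : ℕ, 2 * m ≤ N → F (2 * m) * F 2 =
      F (m - 1) ^ 2 * F m * F (m + 2) - F (m - 2) * F m * F (m + 1) ^ 2) (m : ℤ) :
    F (2 * m) * F 2 = F (m - 1) ^ 2 * F m * F (m + 2) - F (m - 2) * F m * F (m + 1) ^ 2 := by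
  have hv := hF.v_ne_zero
  revert m
  refine forall_int_of_add_of_neg (j := 0) hN le_rfl zero_le_one (fun m ↦ ?_) (fun m hm ↦ ?_) h
  · have h2 := hF.two_mul_add m 0
    have hc : u ^ 4 * (v ^ m) ^ 4 ≠ 0 :=
      mul_ne_zero (pow_ne_zero _ hF.u_ne_zero) (pow_ne_zero _ (zpow_ne_zero _ hv))
    simp only [add_zero, mul_zero, zpow_zero, mul_one] at h2
    rw [h2, hF.add_add, hF.add_add, hF.add_sub, hF.add_sub,
      hF.add_eq]
    refine Iff.trans (iff_of_eq ?_) (mul_right_inj' hc)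
    simp only [zpow_ofNat]
    congr 1 <;> field_simp
  · have h1 : F (2 * -m) = -F (2 * m) := by rw [← hF.neg_eq]; ring_nf
    have h2 : F (-m - 1) = -F (m + 1) := by rw [← hF.neg_eq]; ring_nf
    have h3 : F (-m + 2) = -F (m - 2) := by rw [← hF.neg_eq]; ring_nf
    have h4 : F (-m - 2) = -F (m + 2) := by rw [← hF.neg_eq]; ring_nf
    have h5 : F (-m + 1) = -F (m - 1) := by rw [← hF.neg_eq]; ring_nf
    rw [sub_zero, h1, h2, h3, h4, h5, hF.neg_eq]
    linear_combination -hm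

theorem odd_rel (hF : IsQuasiPeriodic F N u v) (hN : 0 < N)
    (h : ∀ m : ℕ, 2 * m ≤ N → F (2 * m + 1) =
      F (m + 2) * F m ^ 3 - F (m - 1) * F (m + 1) ^ 3) (m : ℤ) :
    F (2 * m + 1) = F (m + 2) * F m ^ 3 - F (m - 1) * F (m + 1) ^ 3 := by
  have hv := hF.v_ne_zero
  revert m
  refine forall_int_of_add_of_neg (j := 1) hN zero_le_one le_rfl (fun m ↦ ?_) (fun m hm ↦ ?_) h
  -- The offsets now sum to 2, which accounts for the factor v²; the reflection 2m + 1 ↦ -(2m + 1)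
  -- is m ↦ -m - 1.
  · have hc : u ^ 4 * (v ^ m) ^ 4 * v ^ 2 ≠ 0 :=
      mul_ne_zero (mul_ne_zero (pow_ne_zero _ hF.u_ne_zero) (pow_ne_zero _ (zpow_ne_zero _ hv)))
        (pow_ne_zero _ hv)
    rw [hF.two_mul_add, hF.add_add, hF.add_add, hF.add_sub,
      hF.add_eq]
    refine Iff.trans (iff_of_eq ?_) (mul_right_inj' hc)
    simp only [zpow_ofNat, mul_one]
    congr 1
    field_simp
  · have h1 : F (2 * (-m - 1) + 1) = -F (2 * m + 1) := by rw [← hF.neg_eq]; ring_nf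
    have h2 : F (-m - 1 + 2) = -F (m - 1) := by rw [← hF.neg_eq]; ring_nf
    have h3 : F (-m - 1) = -F (m + 1) := by rw [← hF.neg_eq]; ring_nf
    have h4 : F (-m - 1 - 1) = -F (m + 2) := by rw [← hF.neg_eq]; ring_nf
    rw [h1, h2, h3, h4, sub_add_cancel, hF.neg_eq]
    linear_combination -hm

/-- All terms are cubic with offsets summing to 0, so the coefficients s and t are unconstrained. -/
theorem invariant_rel (hF : IsQuasiPeriodic F N u v) (hN : 0 < N) {s t : K}
    (h : ∀ m : ℕ, 2 * m ≤ N → F (m - 1) ^ 2 * F (m + 2) + F (m - 2) * F (m + 1) ^ 2 + s * F m ^ 3 =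
      t * F (m - 1) * F m * F (m + 1)) (m : ℤ) :
    F (m - 1) ^ 2 * F (m + 2) + F (m - 2) * F (m + 1) ^ 2 + s * F m ^ 3 =
      t * F (m - 1) * F m * F (m + 1) := by
  have hv := hF.v_ne_zero
  revert m
  refine forall_int_of_add_of_neg (j := 0) hN le_rfl zero_le_one (fun m ↦ ?_) (fun m hm ↦ ?_) h
  · have hc : u ^ 3 * (v ^ m) ^ 3 ≠ 0 :=
      mul_ne_zero (pow_ne_zero _ hF.u_ne_zero) (pow_ne_zero _ (zpow_ne_zero _ hv))
    rw [hF.add_add, hF.add_add, hF.add_sub, hF.add_sub,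
      hF.add_eq]
    refine Iff.trans (iff_of_eq ?_) (mul_right_inj' hc)
    simp only [zpow_ofNat]
    congr 1 <;> field_simp
  · have h2 : F (-m - 1) = -F (m + 1) := by rw [← hF.neg_eq]; ring_nf
    have h3 : F (-m + 2) = -F (m - 2) := by rw [← hF.neg_eq]; ring_nf
    have h4 : F (-m - 2) = -F (m + 2) := by rw [← hF.neg_eq]; ring_nf
    have h5 : F (-m + 1) = -F (m - 1) := by rw [← hF.neg_eq]; ring_nf
    rw [sub_zero, h2, h3, h4, h5, hF.neg_eq]
    linear_combination -hm

end IsQuasiPeriodic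

/-- A sequence satisfying the recurrences of a normalised elliptic divisibility sequence with
`F 2 ≠ 0` is determined by its initial values. -/
theorem normEDS_eq_of_rel {F : ℤ → K} {b c d : K} (hb : b ≠ 0) (h0 : F 0 = 0) (h1 : F 1 = 1)
    (h2 : F 2 = b) (h3 : F 3 = c) (h4 : F 4 = d * b) (hneg : ∀ n, F (-n) = -F n)
    (heven : ∀ m, F (2 * m) * F 2 =
      F (m - 1) ^ 2 * F m * F (m + 2) - F (m - 2) * F m * F (m + 1) ^ 2)
    (hodd : ∀ m, F (2 * m + 1) = F (m + 2) * F m ^ 3 - F (m - 1) * F (m + 1) ^ 3) (n : ℤ) :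
    normEDS b c d n = F n := by
  have hnat (n : ℕ) : normEDS b c d n = F n := by
    induction n using normEDSRec with
    | zero => simp [h0]
    | one => simp [h1]
    | two => simp [h2]
    | three => simp [h3]
    | four => simp [h4]
    | even m i1 i2 i3 i4 i5 =>
      -- The even recurrence only gives F(2m) F(2), so this is where F(2) ≠ 0 is needed.
      refine mul_right_cancel₀ hb ?_
      have e := normEDS_even b c d (m + 3)
      have e' := heven (m + 3)
      rw [h2] at e'
      push_cast at i1 i2 i3 i4 i5 ⊢
      rw [e, e', show (m : ℤ) + 3 - 1 = m + 2 by ring, show (m : ℤ) + 3 - 2 = m + 1 by ring,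
        show (m : ℤ) + 3 + 1 = m + 4 by ring, show (m : ℤ) + 3 + 2 = m + 5 by ring, i1, i2, i3, i4,
        i5]
    | odd m i1 i2 i3 i4 =>
      have e := normEDS_odd b c d (m + 2)
      have e' := hodd (m + 2)
      push_cast at i1 i2 i3 i4 ⊢
      rw [e, e', show (m : ℤ) + 2 - 1 = m + 1 by ring, show (m : ℤ) + 2 + 1 = m + 3 by ring,
        show (m : ℤ) + 2 + 2 = m + 4 by ring, i1, i2, i3, i4]
  obtain ⟨k, rfl | rfl⟩ := n.eq_nat_or_neg
  · exact hnat k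
  · rw [normEDS_neg, hneg, hnat]

/-- The quasi-periodic extension of the values `f 0, …, f (N - 1)`. -/
noncomputable def quasiPeriodicExtension (N : ℕ) (u v : K) (f : ℕ → K) (n : ℤ) : K :=
  u ^ ((n / N) ^ 2) * v ^ (n / N * (n % N)) * f (n % N).toNat

/-- The exponent q² comes from iterating the translation: the product of u v^(r + iN) over i < q is
u^q v^(qr) (v^N)^(q(q-1)/2), and v^N = u². -/
theorem quasiPeriodicExtension_mul_add {N r : ℕ} (hr : r < N) (u v : K) (f : ℕ → K) (q : ℤ) :
    quasiPeriodicExtension N u v f (N * q + r) = u ^ (q ^ 2) * v ^ (q * r) * f r := by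
  have hN : (N : ℤ) ≠ 0 := by omega
  have h1 : (N * q + r) / (N : ℤ) = q := by
    rw [Int.mul_add_ediv_left _ _ hN, Int.ediv_eq_zero_of_lt (by omega) (by omega), add_zero]
  have h2 : (N * q + r) % (N : ℤ) = r := by
    rw [Int.mul_add_emod_self_left, Int.emod_eq_of_lt (by omega) (by omega)]
  rw [quasiPeriodicExtension, h1, h2, Int.toNat_natCast]

theorem quasiPeriodicExtension_natCast {N r : ℕ} (hr : r < N) (u v : K) (f : ℕ → K) :
    quasiPeriodicExtension N u v f r = f r := by
  simpa using quasiPeriodicExtension_mul_add hr u v f 0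

/-- The hypothesis `hsymm` is oddness within one period: F(N - r) = u v^(-r) F(-r) = -u v^(-r) F(r).
-/
theorem isQuasiPeriodic_quasiPeriodicExtension {N : ℕ} (hN : 0 < N) {u v : K} {f : ℕ → K}
    (hu : u ≠ 0) (hv : v ≠ 0) (huv : u ^ 2 = v ^ N) (h0 : f 0 = 0)
    (hsymm : ∀ r ≤ N, f (N - r) * v ^ r = -u * f r) :
    IsQuasiPeriodic (quasiPeriodicExtension N u v f) N u v := by
  have key (n : ℤ) : ∃ (q : ℤ) (r : ℕ), r < N ∧ n = N * q + r := by
    have h0 := Int.emod_nonneg n (b := N) (by omega)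
    have h1 := Int.emod_lt_of_pos n (b := N) (by omega)
    have h2 := Int.mul_ediv_add_emod n N
    exact ⟨n / N, (n % N).toNat, by omega, by omega⟩
  refine ⟨hu, hv, huv, fun n ↦ ?_, fun n ↦ ?_⟩
  · obtain ⟨q, r, hr, rfl⟩ := key n
    rw [show (N : ℤ) * q + r + N = N * (q + 1) + r by ring, quasiPeriodicExtension_mul_add hr,
      quasiPeriodicExtension_mul_add hr, zpow_add₀ hv, zpow_mul v N, zpow_natCast, ← huv,
      ← zpow_natCast u, ← zpow_mul, add_mul, zpow_add₀ hv, add_sq, zpow_add₀ hu, zpow_add₀ hu]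
    simp
    ring
  · obtain ⟨q, r, hr, rfl⟩ := key n
    rw [quasiPeriodicExtension_mul_add hr]
    -- For r = 0 the complement N - r is not a residue; there both sides vanish because f 0 = 0.
    rcases r.eq_zero_or_pos with rfl | hr0
    · have := quasiPeriodicExtension_mul_add hr u v f (-q)
      simp_all
    · rw [show -((N : ℤ) * q + r) = N * (-(q + 1)) + ((N - r : ℕ) : ℤ) by
        rw [Nat.cast_sub hr.le]; ring, quasiPeriodicExtension_mul_add (by omega),
        Nat.cast_sub hr.le, show -(q + 1) * ((N : ℤ) - r) = -(N * (q + 1)) + q * r + r by ring,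
        zpow_add₀ hv, zpow_add₀ hv, zpow_neg, zpow_mul v N, zpow_natCast, ← huv,
        ← zpow_natCast u, ← zpow_mul, neg_sq, zpow_natCast, mul_assoc, mul_assoc _ (v ^ r),
        mul_comm (v ^ r), hsymm r hr.le, add_sq, zpow_add₀ hu, zpow_add₀ hu]
      push_cast
      rw [mul_add, zpow_add₀ hu]
      simp
      field_simp

end QuasiPeriodic

/-! ### Division polynomials and ω at the point (0, 0). -/

theorem psiAt_zero_zero {K : Type*} [Field K] (W : WeierstrassCurve K) (h₄ : W.a₄ = 0)
    (h₆ : W.a₆ = 0) (n : ℤ) :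
    psiAt W 0 0 n =
      normEDS W.a₃ (W.a₂ * W.a₃ ^ 2) (W.a₃ ^ 3 * (W.a₁ * W.a₂ - W.a₃)) n := by
  rw [psiAt, WeierstrassCurve.ψ, ← Polynomial.coe_evalEvalRingHom, map_normEDS]
  have h2 : Polynomial.evalEvalRingHom 0 0 W.ψ₂ = W.a₃ := by
    simp [WeierstrassCurve.ψ₂, WeierstrassCurve.Affine.polynomialY]
  have h3 : Polynomial.evalEvalRingHom 0 0 (Polynomial.C W.Ψ₃) = W.a₂ * W.a₃ ^ 2 := by
    simp [WeierstrassCurve.Ψ₃, WeierstrassCurve.b₈, h₄, h₆]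
  have h4 : Polynomial.evalEvalRingHom 0 0 (Polynomial.C W.preΨ₄) =
      W.a₃ ^ 3 * (W.a₁ * W.a₂ - W.a₃) := by
    simp [WeierstrassCurve.preΨ₄, WeierstrassCurve.b₄, WeierstrassCurve.b₆,
      WeierstrassCurve.b₈, h₄, h₆]
    ring
  rw [h2, h3, h4]

theorem phiAt_zero_zero {K : Type*} [Field K] (W : WeierstrassCurve K) (n : ℤ) :
    phiAt W 0 0 n = -(psiAt W 0 0 (n + 1) * psiAt W 0 0 (n - 1)) := by
  simp [phiAt, psiAt, WeierstrassCurve.φ, Polynomial.evalEval]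

/-- Splits off m = 0, 1, where m - 1 or m - 2 is negative; from m = k + 2 on, all indices of the
recurrences are natural numbers. -/
theorem forall_nat_of_zero_one_add_two {P : ℕ → Prop} (h0 : P 0) (h1 : P 1) (h2 : ∀ k, P (k + 2))
    (m : ℕ) : P m := by
  rcases m with _ | _ | k
  exacts [h0, h1, h2 k]

/-- The values `f 0, …, f (N + 1)` satisfy the recurrences of the division polynomials of `W` at
the point `(0, 0)` of order `N`, and `u`, `v` are the multipliers of the translation by `N`. -/
structure TorsionData (W : WeierstrassCurve ℚ) (N : ℕ) (u v : ℚ) (f : ℕ → ℚ) : Prop where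
  a₄_eq : W.a₄ = 0
  a₆_eq : W.a₆ = 0
  a₃_ne : W.a₃ ≠ 0
  four_le : 4 ≤ N
  u_ne : u ≠ 0
  v_ne : v ≠ 0
  sq_eq : u ^ 2 = v ^ N
  zero : f 0 = 0
  one : f 1 = 1
  two : f 2 = W.a₃
  three : f 3 = W.a₂ * W.a₃ ^ 2
  four : f 4 = W.a₃ ^ 3 * (W.a₁ * W.a₂ - W.a₃) * W.a₃
  succ : f (N + 1) = u * v
  symm : ∀ r ≤ N, f (N - r) * v ^ r = -u * f r
  even : ∀ k, 2 * (k + 2) ≤ N → f (2 * k + 4) * f 2 =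
    f (k + 1) ^ 2 * f (k + 2) * f (k + 4) - f k * f (k + 2) * f (k + 3) ^ 2
  odd : ∀ k, 2 * (k + 2) ≤ N → f (2 * k + 5) =
    f (k + 4) * f (k + 2) ^ 3 - f (k + 1) * f (k + 3) ^ 3
  invariant : ∀ k, 2 * (k + 2) ≤ N →
    f (k + 1) ^ 2 * f (k + 4) + f k * f (k + 3) ^ 2 + W.a₃ ^ 2 * f (k + 2) ^ 3 =
      W.a₁ * W.a₃ * f (k + 1) * f (k + 2) * f (k + 3)

namespace TorsionData

variable {W : WeierstrassCurve ℚ} {N : ℕ} {u v : ℚ} {f : ℕ → ℚ}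

theorem isQuasiPeriodic (h : TorsionData W N u v f) :
    IsQuasiPeriodic (quasiPeriodicExtension N u v f) N u v :=
  isQuasiPeriodic_quasiPeriodicExtension (by have := h.four_le; omega) h.u_ne h.v_ne h.sq_eq h.zero
    h.symm

/-- The table must reach N + 1: the index 2k + 5 in the odd recurrence and the computation of H(N -
1) both get that far. -/
theorem extension_eq (h : TorsionData W N u v f) {r : ℕ} (hr : r ≤ N + 1) :
    quasiPeriodicExtension N u v f r = f r := by
  have hN := h.four_le
  rcases lt_trichotomy r N with h1 | rfl | h1
  · exact quasiPeriodicExtension_natCast h1 u v f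
  -- The symmetry at r = 0 forces f N = 0.
  · have := h.symm 0 (Nat.zero_le _)
    have h2 := quasiPeriodicExtension_mul_add (show 0 < r by omega) u v f 1
    simp_all [h.zero]
  · obtain rfl : r = N + 1 := by omega
    have h2 := quasiPeriodicExtension_mul_add (show 1 < N by omega) u v f 1
    rw [h.succ]
    simpa [h.one] using h2

theorem extension_neg_one (h : TorsionData W N u v f) :
    quasiPeriodicExtension N u v f (-1) = -1 := by
  have h1 := h.extension_eq (r := 1) (by omega)
  rw [h.isQuasiPeriodic.neg_eq]
  simp_all [h.one]

theorem psiAt_eq (h : TorsionData W N u v f) (n : ℤ) :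
    psiAt W 0 0 n = quasiPeriodicExtension N u v f n := by
  have hN := h.four_le
  have hF := h.isQuasiPeriodic
  have e0 := h.extension_eq (r := 0) (by omega)
  have e1 := h.extension_eq (r := 1) (by omega)
  have e2 := h.extension_eq (r := 2) (by omega)
  have e3 := h.extension_eq (r := 3) (by omega)
  have e4 := h.extension_eq (r := 4) (by omega)
  have en := h.extension_neg_one
  have hr := fun r ↦ h.extension_eq (r := r)
  rw [psiAt_zero_zero W h.a₄_eq h.a₆_eq]
  generalize quasiPeriodicExtension N u v f = F at hF e0 e1 e2 e3 e4 en hr ⊢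
  rw [h.zero] at e0
  rw [h.one] at e1
  push_cast at e0 e1 e2 e3 e4
  refine normEDS_eq_of_rel h.a₃_ne e0 e1 (e2.trans h.two) (e3.trans h.three) (e4.trans h.four)
    hF.neg_eq (hF.even_rel (by omega) ?_) (hF.odd_rel (by omega) ?_) n
  · refine forall_nat_of_zero_one_add_two ?_ ?_ fun k hk ↦ ?_
    · simp [e0, hF.neg_eq]
    · simp [e0, e1, en, sq]
    · have := h.even k hk
      rw [← hr _ (by omega), ← hr _ (by omega), ← hr _ (by omega), ← hr _ (by omega),
        ← hr _ (by omega), ← hr _ (by omega), ← hr _ (by omega)] at this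
      push_cast at this ⊢
      convert this using 3 <;> ring_nf
  · refine forall_nat_of_zero_one_add_two ?_ ?_ fun k hk ↦ ?_
    · simp [e0, e1, en]
    · simp [e0, e1]
    · have := h.odd k hk
      rw [← hr _ (by omega), ← hr _ (by omega), ← hr _ (by omega), ← hr _ (by omega),
        ← hr _ (by omega)] at this
      push_cast at this ⊢
      rw [show (2 : ℤ) * (k + 2) + 1 = 2 * k + 5 by ring]
      convert this using 3 <;> ring_nf

theorem psiAt_two (h : TorsionData W N u v f) : psiAt W 0 0 2 = W.a₃ := by
  rw [psiAt_zero_zero W h.a₄_eq h.a₆_eq, normEDS_two]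

/-- This is the classical invariant of an elliptic divisibility sequence, whose constant is a₁a₃ at
(0, 0). It is obtained here from its instances in half a period. -/
theorem psiAt_invariant (h : TorsionData W N u v f) (n : ℤ) :
    psiAt W 0 0 (n - 1) ^ 2 * psiAt W 0 0 (n + 2) + psiAt W 0 0 (n - 2) * psiAt W 0 0 (n + 1) ^ 2 +
        W.a₃ ^ 2 * psiAt W 0 0 n ^ 3 =
      W.a₁ * W.a₃ * psiAt W 0 0 (n - 1) * psiAt W 0 0 n * psiAt W 0 0 (n + 1) := by
  have hN := h.four_le
  have hF := h.isQuasiPeriodic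
  have e0 := h.extension_eq (r := 0) (by omega)
  have e1 := h.extension_eq (r := 1) (by omega)
  have e2 := h.extension_eq (r := 2) (by omega)
  have en := h.extension_neg_one
  have hr := fun r ↦ h.extension_eq (r := r)
  simp only [h.psiAt_eq]
  generalize quasiPeriodicExtension N u v f = F at hF e0 e1 e2 en hr ⊢
  rw [h.zero] at e0
  rw [h.one] at e1
  rw [h.two] at e2
  push_cast at e0 e1 e2
  refine hF.invariant_rel (by omega) ?_ n
  refine forall_nat_of_zero_one_add_two ?_ ?_ fun k hk ↦ ?_
  · simp [e0, e1, en, hF.neg_eq]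
  · simp [e0, e1, e2, en]
  · have := h.invariant k hk
    rw [← hr _ (by omega), ← hr _ (by omega), ← hr _ (by omega), ← hr _ (by omega),
      ← hr _ (by omega)] at this
    push_cast at this ⊢
    convert this using 3 <;> ring_nf

/-- As x = 0, φ(n) = -ψ(n+1) ψ(n-1). The invariant then rewrites the a₁, a₃ part of the numerator of
ω as ψ(n-1)² ψ(n+2) + ψ(n-2) ψ(n+1)²; the second terms cancel and the first ones double. -/
theorem H_mul_eq (h : TorsionData W N u v f) (n : ℕ) :
    H W n * W.a₃ = psiAt W 0 0 (n - 1) ^ 2 * psiAt W 0 0 (n + 2) := by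
  have h3 := h.a₃_ne
  rcases n with _ | _ | n
  · have := h.extension_neg_one
    simp [H, omegaAt, h.psiAt_two, h.psiAt_eq (-1), this]
  · have := h.extension_eq (r := 0) (by omega)
    simp_all [H, omegaAt, h.psiAt_eq 0, h.zero]
  · have := h.psiAt_invariant (n + 2 : ℕ)
    simp only [H, omegaAt, phiAt_zero_zero, h.psiAt_two]
    field_simp
    linear_combination -this

/-- The multiplier is (u v^(n-1))² · u v^(n+2). -/
theorem H_add (h : TorsionData W N u v f) (n : ℕ) : H W (n + N) = u ^ 3 * (v ^ 3) ^ n * H W n := by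
  have hF := h.isQuasiPeriodic
  have hv := h.v_ne
  refine mul_right_cancel₀ h.a₃_ne ?_
  rw [mul_assoc, h.H_mul_eq, h.H_mul_eq]
  simp only [h.psiAt_eq]
  push_cast
  rw [hF.add_sub, hF.add_add]
  simp only [zpow_natCast, zpow_ofNat]
  field_simp
  ring

theorem H_of_lt (h : TorsionData W N u v f) {n : ℕ} (hn : n + 1 < N) :
    H W (n + 1) * W.a₃ = f n ^ 2 * f (n + 3) := by
  rw [h.H_mul_eq, h.psiAt_eq, h.psiAt_eq, ← h.extension_eq (r := n) (by omega),
    ← h.extension_eq (r := n + 3) (by omega)]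
  push_cast
  ring_nf

end TorsionData

/-! ### Tables of division polynomial values for the seven families. -/

/-- The values at `(0, 0)` of the first division polynomials of `E4 a`. -/
def psi4 (a : ℚ) : ℕ → ℚ
  | 1 => 1
  | 2 => -a
  | 3 => -a ^ 3
  | 5 => a ^ 9
  | _ => 0

/-- The symmetry at r = 1, 2 dictates the multipliers, here and for every N: v = f(2) f(N-1) /
f(N-2) and u = -v f(N-1). The default 0 of the table supplies the genuine zeros at 0 and N. -/
theorem torsionData_E4 {a : ℚ} (ha0 : a ≠ 0) :
    TorsionData (E4 a) 4 (-a ^ 6) (-a ^ 3) (psi4 a) := by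
  have h1 : (E4 a).a₁ = 1 := by simp [E4, tate]
  have h2 : (E4 a).a₂ = -a := by simp [E4, tate]
  have h3 : (E4 a).a₃ = -a := by simp [E4, tate]
  refine ⟨by simp [E4, tate], by simp [E4, tate], ?_, by norm_num, ?_, ?_, ?_, rfl, rfl, ?_, ?_, ?_,
    ?_, fun r hr ↦ ?_, fun k hk ↦ ?_, fun k hk ↦ ?_, fun k hk ↦ ?_⟩
  · simp [h3, ha0]
  · simp [ha0]
  · simp [ha0]
  · ring
  · simp only [psi4, h3]
  · simp only [psi4, h2, h3]; ring
  · simp only [psi4, h1, h2, h3]; ring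
  · simp only [psi4]; ring
  · interval_cases r <;> simp only [tsub_self, psi4] <;> ring
  · have hk : k < 1 := by omega
    interval_cases k; simp only [psi4]
    · ring
  · have hk : k < 1 := by omega
    interval_cases k; simp only [psi4]
    · ring
  · have hk : k < 1 := by omega
    interval_cases k; simp only [psi4, h1, h3]
    · ring

/-- The values at `(0, 0)` of the first division polynomials of `E5 a`. -/
def psi5 (a : ℚ) : ℕ → ℚ
  | 1 => 1
  | 2 => -a
  | 3 => -a ^ 3
  | 4 => a ^ 6
  | 6 => -a ^ 14
  | _ => 0

theorem torsionData_E5 {a : ℚ} (ha0 : a ≠ 0) :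
    TorsionData (E5 a) 5 (-a ^ 10) (a ^ 4) (psi5 a) := by
  have h1 : (E5 a).a₁ = 1 - a := by simp [E5, tate]
  have h2 : (E5 a).a₂ = -a := by simp [E5, tate]
  have h3 : (E5 a).a₃ = -a := by simp [E5, tate]
  refine ⟨by simp [E5, tate], by simp [E5, tate], ?_, by norm_num, ?_, ?_, ?_, rfl, rfl, ?_, ?_, ?_,
    ?_, fun r hr ↦ ?_, fun k hk ↦ ?_, fun k hk ↦ ?_, fun k hk ↦ ?_⟩
  · simp [h3, ha0]
  · simp [ha0]
  · simp [ha0]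
  · ring
  · simp only [psi5, h3]
  · simp only [psi5, h2, h3]; ring
  · simp only [psi5, h1, h2, h3]; ring
  · simp only [psi5]; ring
  · interval_cases r <;> simp only [tsub_self, psi5] <;> ring
  · have hk : k < 1 := by omega
    interval_cases k; simp only [psi5]
    · ring
  · have hk : k < 1 := by omega
    interval_cases k; simp only [psi5]
    · ring
  · have hk : k < 1 := by omega
    interval_cases k; simp only [psi5, h1, h3]
    · ring

/-- The values at `(0, 0)` of the first division polynomials of `E6 a`. -/
def psi6 (a p : ℚ) : ℕ → ℚ
  | 1 => 1
  | 2 => -(a * p)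
  | 3 => -(a ^ 3 * p ^ 3)
  | 4 => a ^ 6 * p ^ 5
  | 5 => a ^ 10 * p ^ 8
  | 7 => -(a ^ 20 * p ^ 16)
  | _ => 0

/-- The factor p is kept as a separate symbol, so table entries stay monomials. A recurrence that is
not an identity of monomials becomes, after removing the common monomial, one of the short relations
r1, r2, r3 between a and p. The later families follow the same pattern with more factors. -/
theorem torsionData_E6 {a p : ℚ} (hp : p = a + 1) (ha0 : a ≠ 0) (hp0 : p ≠ 0) :
    TorsionData (E6 a) 6 (a ^ 15 * p ^ 12) (-(a ^ 5 * p ^ 4)) (psi6 a p) := by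
  have h1 : (E6 a).a₁ = 1 - a := by simp [E6, tate]
  have h2 : (E6 a).a₂ = -(a * p) := by simp only [E6, tate, hp]; ring
  have h3 : (E6 a).a₃ = -(a * p) := by simp only [E6, tate, hp]; ring
  have r1 : -a - 1 + p = 0 := by simp only [hp]; ring
  have r2 : a - p + 1 = 0 := by simp only [hp]; ring
  have r3 : 2 * a - p + (1 - a) = 0 := by simp only [hp]; ring
  refine ⟨by simp [E6, tate], by simp [E6, tate], ?_, by norm_num, ?_, ?_, ?_, rfl, rfl, ?_, ?_, ?_,
    ?_, fun r hr ↦ ?_, fun k hk ↦ ?_, fun k hk ↦ ?_, fun k hk ↦ ?_⟩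
  · simp [h3, ha0, hp0]
  · simp [ha0, hp0]
  · simp [ha0, hp0]
  · ring
  · simp only [psi6, h3]
  · simp only [psi6, h2, h3]; ring
  · simp only [psi6, h1, h2, h3]; ring
  · simp only [psi6]; ring
  · interval_cases r <;> simp only [tsub_self, psi6] <;> ring
  · have hk : k < 2 := by omega
    interval_cases k <;> simp only [psi6]
    · ring
    · ring
  · have hk : k < 2 := by omega
    interval_cases k <;> simp only [psi6]
    · linear_combination -(a ^ 9 * p ^ 8) * r1
    · linear_combination -(a ^ 19 * p ^ 16) * r2
  · have hk : k < 2 := by omega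
    interval_cases k <;> simp only [psi6, h1, h3]
    · ring
    · linear_combination (a ^ 11 * p ^ 10) * r3

/-- The values at `(0, 0)` of the first division polynomials of `E7 a`. -/
def psi7 (a p : ℚ) : ℕ → ℚ
  | 1 => 1
  | 2 => -(a ^ 2 * p)
  | 3 => -(a ^ 6 * p ^ 3)
  | 4 => a ^ 11 * p ^ 6
  | 5 => a ^ 17 * p ^ 10
  | 6 => -(a ^ 25 * p ^ 15)
  | 8 => a ^ 45 * p ^ 27
  | _ => 0

theorem torsionData_E7 {a p : ℚ} (hp : p = a - 1) (ha0 : a ≠ 0) (hp0 : p ≠ 0) :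
    TorsionData (E7 a) 7 (a ^ 35 * p ^ 21) (a ^ 10 * p ^ 6) (psi7 a p) := by
  have h1 : (E7 a).a₁ = 1 - a * p := by simp only [E7, tate, hp]; ring
  have h2 : (E7 a).a₂ = -(a ^ 2 * p) := by simp only [E7, tate, hp]; ring
  have h3 : (E7 a).a₃ = -(a ^ 2 * p) := by simp only [E7, tate, hp]; ring
  have r1 : -p - 1 + a = 0 := by simp only [hp]; ring
  have r2 : p + a * p - a + (1 - a * p) = 0 := by simp only [hp]; ring
  refine ⟨by simp [E7, tate], by simp [E7, tate], ?_, by norm_num, ?_, ?_, ?_, rfl, rfl, ?_, ?_, ?_,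
    ?_, fun r hr ↦ ?_, fun k hk ↦ ?_, fun k hk ↦ ?_, fun k hk ↦ ?_⟩
  · simp [h3, ha0, hp0]
  · simp [ha0, hp0]
  · simp [ha0, hp0]
  · ring
  · simp only [psi7, h3]
  · simp only [psi7, h2, h3]; ring
  · simp only [psi7, h1, h2, h3]; ring
  · simp only [psi7]; ring
  · interval_cases r <;> simp only [tsub_self, psi7] <;> ring
  · have hk : k < 2 := by omega
    interval_cases k <;> simp only [psi7]
    · ring
    · linear_combination -(a ^ 27 * p ^ 15) * r1
  · have hk : k < 2 := by omega
    interval_cases k <;> simp only [psi7]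
    · linear_combination -(a ^ 17 * p ^ 9) * r1
    · ring
  · have hk : k < 2 := by omega
    interval_cases k <;> simp only [psi7, h1, h3]
    · ring
    · linear_combination (a ^ 21 * p ^ 11) * r2

/-- The values at `(0, 0)` of the first division polynomials of `E9 a`. -/
def psi9 (a p e : ℚ) : ℕ → ℚ
  | 1 => 1
  | 2 => -(a ^ 2 * p * e)
  | 3 => -(a ^ 6 * p ^ 3 * e ^ 3)
  | 4 => a ^ 12 * p ^ 6 * e ^ 5
  | 5 => a ^ 19 * p ^ 10 * e ^ 8
  | 6 => -(a ^ 27 * p ^ 15 * e ^ 12)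
  | 7 => -(a ^ 37 * p ^ 21 * e ^ 16)
  | 8 => a ^ 49 * p ^ 28 * e ^ 21
  | 10 => -(a ^ 77 * p ^ 44 * e ^ 33)
  | _ => 0

theorem torsionData_E9 {a p e : ℚ} (hp : p = a - 1) (he : e = eta a) (ha0 : a ≠ 0) (hp0 : p ≠ 0)
    (he0 : e ≠ 0) :
    TorsionData (E9 a) 9 (-(a ^ 63 * p ^ 36 * e ^ 27)) (a ^ 14 * p ^ 8 * e ^ 6) (psi9 a p e) := by
  have h1 : (E9 a).a₁ = 1 - a ^ 2 * p := by simp only [E9, tate, hp]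
  have h2 : (E9 a).a₂ = -(a ^ 2 * p * e) := by simp only [E9, tate, hp, he, eta]; ring
  have h3 : (E9 a).a₃ = -(a ^ 2 * p * e) := by simp only [E9, tate, hp, he, eta]; ring
  have r1 : -a * p - 1 + e = 0 := by simp only [hp, he, eta]; ring
  have r2 : -p - 1 + a = 0 := by simp only [hp]; ring
  have r3 : p ^ 2 - e + a = 0 := by simp only [hp, he, eta]; ring
  have r4 : a * p + a ^ 2 * p - e + (1 - a ^ 2 * p) = 0 := by simp only [hp, he, eta]; ring
  have r5 : -p * e - a * p + a - (1 - a ^ 2 * p) = 0 := by simp only [hp, he, eta]; ring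
  refine ⟨by simp [E9, tate], by simp [E9, tate], ?_, by norm_num, ?_, ?_, ?_, rfl, rfl, ?_, ?_, ?_,
    ?_, fun r hr ↦ ?_, fun k hk ↦ ?_, fun k hk ↦ ?_, fun k hk ↦ ?_⟩
  · simp [h3, ha0, hp0, he0]
  · simp [ha0, hp0, he0]
  · simp [ha0, hp0, he0]
  · ring
  · simp only [psi9, h3]
  · simp only [psi9, h2, h3]; ring
  · simp only [psi9, h1, h2, h3]; ring
  · simp only [psi9]; ring
  · interval_cases r <;> simp only [tsub_self, psi9] <;> ring
  · have hk : k < 3 := by omega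
    interval_cases k <;> simp only [psi9]
    · ring
    · linear_combination -(a ^ 29 * p ^ 15 * e ^ 13) * r2
    · linear_combination -(a ^ 51 * p ^ 27 * e ^ 22) * r3
  · have hk : k < 3 := by omega
    interval_cases k <;> simp only [psi9]
    · linear_combination -(a ^ 18 * p ^ 9 * e ^ 8) * r1
    · linear_combination -(a ^ 37 * p ^ 19 * e ^ 16) * r3
    · ring
  · have hk : k < 3 := by omega
    interval_cases k <;> simp only [psi9, h1, h3]
    · ring
    · linear_combination (a ^ 22 * p ^ 11 * e ^ 10) * r4
    · linear_combination (a ^ 39 * p ^ 20 * e ^ 17) * r5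

/-- The values at `(0, 0)` of the first division polynomials of `E10 a`. -/
def psi10 (a p w z : ℚ) : ℕ → ℚ
  | 1 => 1
  | 2 => -(a ^ 3 * p * w * z ^ 4)
  | 3 => -(a ^ 9 * p ^ 3 * w ^ 3 * z ^ 10)
  | 4 => a ^ 16 * p ^ 6 * w ^ 6 * z ^ 19
  | 5 => a ^ 25 * p ^ 10 * w ^ 10 * z ^ 30
  | 6 => -(a ^ 37 * p ^ 15 * w ^ 14 * z ^ 44)
  | 7 => -(a ^ 51 * p ^ 21 * w ^ 19 * z ^ 60)
  | 8 => a ^ 66 * p ^ 28 * w ^ 25 * z ^ 79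
  | 9 => a ^ 84 * p ^ 36 * w ^ 32 * z ^ 100
  | 11 => -(a ^ 126 * p ^ 54 * w ^ 48 * z ^ 150)
  | _ => 0

theorem torsionData_E10 {a p w z : ℚ} (hp : p = a - 1) (hw : w = 2 * a - 1) (hz : z = zeta a)
    (ha0 : a ≠ 0) (hp0 : p ≠ 0) (hw0 : w ≠ 0) (hz0 : z ≠ 0) :
    TorsionData (E10 a) 10 (a ^ 105 * p ^ 45 * w ^ 40 * z ^ 125) (-(a ^ 21 * p ^ 9 * w ^ 8 *
      z ^ 25)) (psi10 a p w z) := by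
  have h1 : (E10 a).a₁ = z * (z - a * p * w) := by simp only [E10, beta, hp, hw, hz]; ring
  have h2 : (E10 a).a₂ = -(a ^ 3 * p * w * z ^ 2) := by simp only [E10, beta, hp, hw, hz]; ring
  have h3 : (E10 a).a₃ = -(a ^ 3 * p * w * z ^ 4) := by simp only [E10, beta, hp, hw, hz]; ring
  have r1 : -p * w - z + a ^ 2 = 0 := by simp only [hp, hw, hz, zeta]; ring
  have r2 : -p - 1 + a = 0 := by simp only [hp]; ring
  have r3 : p ^ 2 - a + z = 0 := by simp only [hp, hz, zeta]; ring
  have r4 : p * w + a * p * w - a ^ 2 + (z - a * p * w) = 0 := by simp only [hp, hw, hz, zeta]; ring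
  have r5 : p ^ 2 - a ^ 2 + w = 0 := by simp only [hp, hw]; ring
  have r6 : -p ^ 3 - a * z + w = 0 := by simp only [hp, hw, hz, zeta]; ring
  have r7 : -a ^ 2 * p - p * w + a * z - (z - a * p * w) = 0 := by
    simp only [hp, hw, hz, zeta]
    ring
  have r8 : p ^ 3 - w + a * z = 0 := by simp only [hp, hw, hz, zeta]; ring
  have r9 : -2 * a ^ 2 * p + w - (z - a * p * w) = 0 := by simp only [hp, hw, hz, zeta]; ring
  refine ⟨by simp [E10], by simp [E10], ?_, by norm_num, ?_, ?_, ?_, rfl, rfl, ?_, ?_, ?_,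
    ?_, fun r hr ↦ ?_, fun k hk ↦ ?_, fun k hk ↦ ?_, fun k hk ↦ ?_⟩
  · simp [h3, ha0, hp0, hw0, hz0]
  · simp [ha0, hp0, hw0, hz0]
  · simp [ha0, hp0, hw0, hz0]
  · ring
  · simp only [psi10, h3]
  · simp only [psi10, h2, h3]; ring
  · simp only [psi10, h1, h2, h3]; ring
  · simp only [psi10]; ring
  · interval_cases r <;> simp only [tsub_self, psi10] <;> ring
  · have hk : k < 4 := by omega
    interval_cases k <;> simp only [psi10]
    · ring
    · linear_combination -(a ^ 40 * p ^ 15 * w ^ 15 * z ^ 48) * r2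
    · linear_combination -(a ^ 69 * p ^ 27 * w ^ 26 * z ^ 83) * r5
    · ring
  · have hk : k < 4 := by omega
    interval_cases k <;> simp only [psi10]
    · linear_combination -(a ^ 25 * p ^ 9 * w ^ 9 * z ^ 30) * r1
    · linear_combination -(a ^ 51 * p ^ 19 * w ^ 19 * z ^ 60) * r3
    · linear_combination -(a ^ 84 * p ^ 33 * w ^ 32 * z ^ 100) * r6
    · linear_combination -(a ^ 126 * p ^ 51 * w ^ 48 * z ^ 150) * r8
  · have hk : k < 4 := by omega
    interval_cases k <;> simp only [psi10, h1, h3]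
    · ring
    · linear_combination (a ^ 31 * p ^ 11 * w ^ 11 * z ^ 38) * r4
    · linear_combination (a ^ 53 * p ^ 20 * w ^ 20 * z ^ 64) * r7
    · linear_combination (a ^ 81 * p ^ 32 * w ^ 31 * z ^ 98) * r9

/-- The values at `(0, 0)` of the first division polynomials of `E12 a`. -/
def psi12 (a p w l t : ℚ) : ℕ → ℚ
  | 1 => 1
  | 2 => -(p ^ 8 * l * t)
  | 3 => -(p ^ 20 * l ^ 3 * t ^ 3)
  | 4 => p ^ 37 * l ^ 6 * t ^ 5
  | 5 => -(a * p ^ 60 * w * l ^ 9 * t ^ 8)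
  | 6 => a ^ 2 * p ^ 86 * w ^ 2 * l ^ 13 * t ^ 12
  | 7 => -(a ^ 3 * p ^ 119 * w ^ 2 * l ^ 18 * t ^ 16)
  | 8 => a ^ 4 * p ^ 155 * w ^ 2 * l ^ 24 * t ^ 21
  | 9 => -(a ^ 6 * p ^ 197 * w ^ 3 * l ^ 30 * t ^ 27)
  | 10 => -(a ^ 8 * p ^ 244 * w ^ 4 * l ^ 37 * t ^ 33)
  | 11 => a ^ 10 * p ^ 295 * w ^ 5 * l ^ 45 * t ^ 40
  | 13 => -(a ^ 14 * p ^ 413 * w ^ 7 * l ^ 63 * t ^ 56)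
  | _ => 0

theorem torsionData_E12 {a p w l t : ℚ} (hp : p = a - 1) (hw : w = 2 * a - 1) (hl : l = lam a)
    (ht : t = theta a) (ha0 : a ≠ 0) (hp0 : p ≠ 0) (hw0 : w ≠ 0) (hl0 : l ≠ 0) (ht0 : t ≠ 0) :
    TorsionData (E12 a) 12 (-(a ^ 12 * p ^ 354 * w ^ 6 * l ^ 54 * t ^ 48)) (a ^ 2 * p ^ 59 * w *
      l ^ 9 * t ^ 8) (psi12 a p w l t) := by
  have h1 : (E12 a).a₁ = p * (p ^ 3 - l) := by simp only [E12, hp, hl]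
  have h2 : (E12 a).a₂ = -(p ^ 4 * l * t) := by simp only [E12, hp, hl, ht]
  have h3 : (E12 a).a₃ = -(p ^ 8 * l * t) := by simp only [E12, hp, hl, ht]
  have r1 : a * w - p + t = 0 := by simp only [hp, hw, ht, theta]; ring
  have r2 : a ^ 2 * w ^ 2 + a * p ^ 2 * w + l = 0 := by simp only [hp, hw, hl, lam]; ring
  have r3 : a ^ 3 * w ^ 2 + a * p * w * t + l = 0 := by simp only [hp, hw, hl, ht, lam, theta]; ring
  have r4 : -a * p ^ 2 * w + l - p ^ 2 * t + (p ^ 3 - l) = 0 := by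
    simp only [hp, hw, hl, ht, lam, theta]
    ring
  have r5 : a ^ 2 + t + p ^ 2 = 0 := by simp only [hp, ht, theta]; ring
  have r6 : a ^ 4 * w + l - a * p ^ 3 * w = 0 := by simp only [hp, hw, hl, lam]; ring
  have r7 : a ^ 2 * w ^ 2 * t - a ^ 2 * p ^ 2 * w ^ 2 + p * l + a * w * (p ^ 3 - l) = 0 := by
    simp only [hp, hw, hl, ht, lam, theta]
    ring
  have r8 : -a ^ 4 * w + p * l - a * w ^ 2 * t = 0 := by
    simp only [hp, hw, hl, ht, lam, theta]
    ring
  have r9 : -a ^ 4 + p ^ 4 - w * t = 0 := by simp only [hp, hw, ht, theta]; ring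
  have r10 : -p * l - a * w ^ 2 * t - p ^ 4 * w - w * (p ^ 3 - l) = 0 := by
    simp only [hp, hw, hl, ht, lam, theta]
    ring
  have r11 : a ^ 4 + w * t - p ^ 4 = 0 := by simp only [hp, hw, ht, theta]; ring
  have r12 : 2 * p * l + w ^ 2 * t + w * (p ^ 3 - l) = 0 := by
    simp only [hp, hw, hl, ht, lam, theta]
    ring
  refine ⟨by simp [E12], by simp [E12], ?_, by norm_num, ?_, ?_, ?_, rfl, rfl, ?_, ?_, ?_,
    ?_, fun r hr ↦ ?_, fun k hk ↦ ?_, fun k hk ↦ ?_, fun k hk ↦ ?_⟩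
  · simp [h3, hp0, hl0, ht0]
  · simp [ha0, hp0, hw0, hl0, ht0]
  · simp [ha0, hp0, hw0, hl0, ht0]
  · ring
  · simp only [psi12, h3]
  · simp only [psi12, h2, h3]; ring
  · simp only [psi12, h1, h2, h3]; ring
  · simp only [psi12]; ring
  · interval_cases r <;> simp only [tsub_self, psi12] <;> ring
  · have hk : k < 5 := by omega
    interval_cases k <;> simp only [psi12]
    · ring
    · linear_combination -(p ^ 94 * l ^ 14 * t ^ 13) * r2
    · linear_combination -(a ^ 2 * p ^ 163 * w ^ 2 * l ^ 25 * t ^ 22) * r5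
    · linear_combination -(a ^ 4 * p ^ 252 * w ^ 3 * l ^ 38 * t ^ 34) * r8
    · ring
  · have hk : k < 5 := by omega
    interval_cases k <;> simp only [psi12]
    · linear_combination -(p ^ 60 * l ^ 9 * t ^ 8) * r1
    · linear_combination -(p ^ 119 * l ^ 18 * t ^ 16) * r3
    · linear_combination -(a ^ 2 * p ^ 197 * w ^ 2 * l ^ 30 * t ^ 27) * r6
    · linear_combination -(a ^ 6 * p ^ 295 * w ^ 5 * l ^ 45 * t ^ 40) * r9
    · linear_combination -(a ^ 10 * p ^ 413 * w ^ 7 * l ^ 63 * t ^ 56) * r11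
  · have hk : k < 5 := by omega
    interval_cases k <;> simp only [psi12, h1, h3]
    · ring
    · linear_combination (p ^ 74 * l ^ 11 * t ^ 10) * r4
    · linear_combination (p ^ 126 * l ^ 19 * t ^ 17) * r7
    · linear_combination (a ^ 3 * p ^ 192 * w ^ 2 * l ^ 29 * t ^ 26) * r10
    · linear_combination (a ^ 6 * p ^ 274 * w ^ 4 * l ^ 41 * t ^ 37) * r12

/-! ### Closed formulas for H, by induction in steps of N. -/

theorem forall_nat_of_add {P : ℕ → Prop} {N : ℕ} (hN : 0 < N) (h : ∀ n < N, P n)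
    (hadd : ∀ n, P n → P (n + N)) : ∀ n, P n := by
  intro n
  induction n using Nat.strong_induction_on with
  | _ n ih =>
    rcases lt_or_ge n N with hn | hn
    · exact h n hn
    · rw [← Nat.sub_add_cancel hn]
      exact hadd _ (ih _ (by omega))

theorem H_zero (W : WeierstrassCurve ℚ) : H W 0 = 1 := rfl

theorem H_one (W : WeierstrassCurve ℚ) : H W 1 = 0 := rfl

theorem TorsionData.H_eq_of_mul_eq {W : WeierstrassCurve ℚ} {N : ℕ} {u v : ℚ} {f : ℕ → ℚ}
    (h : TorsionData W N u v f) {n : ℕ} {x : ℚ} (hn : n + 1 < N)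
    (hx : f n ^ 2 * f (n + 3) = x * W.a₃) : H W (n + 1) = x :=
  mul_right_cancel₀ h.a₃_ne ((h.H_of_lt hn).trans hx)

/-- The sign of u³ v^(3n), with u and v both carrying a minus sign. The claim has period 8 in n, so
one period decides it; on the vanishing classes both sides are the default 0. -/
theorem eps4_add (n : ℕ) : eps4 (n + 4) = -((-1) ^ n * eps4 n) := by
  revert n
  refine forall_nat_of_add (N := 8) (by norm_num) (by decide) fun n hn ↦ ?_
  simpa [eps4, pow_add, add_right_comm n] using hn

theorem H_E4 {a : ℚ} (ha0 : a ≠ 0) (n : ℕ) :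
    ((n % 4 = 1 ∨ n % 4 = 2) → H (E4 a) n = 0) ∧
    (¬(n % 4 = 1 ∨ n % 4 = 2) → ∃ i : ℕ,
      8 * (i : ℤ) = 9 * n ^ 2 - a4 n ∧
      H (E4 a) n = (eps4 n : ℚ) * a ^ i) := by
  have h := torsionData_E4 ha0
  have h3 := h.two.symm
  simp only [psi4] at h3
  revert n
  refine forall_nat_of_add (N := 4) (by norm_num) ?_ ?_
  · intro n hn
    interval_cases n
    · exact ⟨by simp, fun _ ↦ ⟨0, rfl, by simp [H_zero, eps4]⟩⟩
    · exact ⟨fun _ ↦ H_one _, by simp⟩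
    · exact ⟨fun _ ↦ h.H_eq_of_mul_eq (by norm_num) (by simp [psi4]), by simp⟩
    -- The witness is (9 · 3² - 1) / 8; the witnesses in the other base cases arise likewise.
    · exact ⟨by simp, fun _ ↦ ⟨10, rfl,
      h.H_eq_of_mul_eq (by norm_num) (by simp only [psi4, eps4, h3]; push_cast; ring)⟩⟩
  · rintro n ⟨hz, hv⟩
    simp only [Nat.add_mod_right]
    refine ⟨fun hn ↦ by rw [h.H_add, hz hn, mul_zero], fun hn ↦ ?_⟩
    obtain ⟨i, hi, hH⟩ := hv hn
    -- The increment 9((n + 4)² - n²) / 8 is the exponent of α in u³ v^(3n).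
    refine ⟨i + 18 + 9 * n, ?_, ?_⟩
    · rw [show a4 (n + 4) = a4 n by simp [a4]]
      push_cast
      linarith
    · rw [h.H_add, hH, eps4_add, show (-a ^ 3) ^ 3 = -1 * (a ^ 9) by ring]
      simp only [mul_pow, ← pow_mul, pow_add]
      push_cast
      ring

theorem eps5_add (n : ℕ) : eps5 (n + 5) = -eps5 n := by
  revert n
  refine forall_nat_of_add (N := 10) (by norm_num) (by decide) fun n hn ↦ ?_
  simpa [eps5, pow_add, add_right_comm n] using hn

theorem H_E5 {a : ℚ} (ha0 : a ≠ 0) (n : ℕ) :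
    ((n % 5 = 1 ∨ n % 5 = 3) → H (E5 a) n = 0) ∧
    (¬(n % 5 = 1 ∨ n % 5 = 3) → ∃ i : ℕ,
      5 * (i : ℤ) = 6 * n ^ 2 - a5 n ∧
      H (E5 a) n = (eps5 n : ℚ) * a ^ i) := by
  have h := torsionData_E5 ha0
  have h3 := h.two.symm
  simp only [psi5] at h3
  revert n
  refine forall_nat_of_add (N := 5) (by norm_num) ?_ ?_
  · intro n hn
    interval_cases n
    · exact ⟨by simp, fun _ ↦ ⟨0, rfl, by simp [H_zero, eps5]⟩⟩
    · exact ⟨fun _ ↦ H_one _, by simp⟩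
    · exact ⟨by simp, fun _ ↦ ⟨5, rfl,
      h.H_eq_of_mul_eq (by norm_num) (by simp only [psi5, eps5, h3]; push_cast; ring)⟩⟩
    · exact ⟨fun _ ↦ h.H_eq_of_mul_eq (by norm_num) (by simp [psi5]), by simp⟩
    · exact ⟨by simp, fun _ ↦ ⟨19, rfl,
      h.H_eq_of_mul_eq (by norm_num) (by simp only [psi5, eps5, h3]; push_cast; ring)⟩⟩
  · rintro n ⟨hz, hv⟩
    simp only [Nat.add_mod_right]
    refine ⟨fun hn ↦ by rw [h.H_add, hz hn, mul_zero], fun hn ↦ ?_⟩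
    obtain ⟨i, hi, hH⟩ := hv hn
    refine ⟨i + 30 + 12 * n, ?_, ?_⟩
    · rw [show a5 (n + 5) = a5 n by simp [a5]]
      push_cast
      linarith
    · rw [h.H_add, hH, eps5_add, show (a ^ 4) ^ 3 = a ^ 12 by ring]
      simp only [← pow_mul, pow_add]
      push_cast
      ring

/-- Only v carries a minus sign here, whence the factor (-1)^n. -/
theorem eps6_add (n : ℕ) : eps6 (n + 6) = ((-1) ^ n * eps6 n) := by
  revert n
  refine forall_nat_of_add (N := 12) (by norm_num) (by decide) fun n hn ↦ ?_
  simpa [eps6, pow_add, add_right_comm n] using hn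

theorem H_E6 {a p : ℚ} (hp : p = a + 1) (ha0 : a ≠ 0) (hp0 : p ≠ 0) (n : ℕ) :
    ((n % 6 = 1 ∨ n % 6 = 4) → H (E6 a) n = 0) ∧
    (¬(n % 6 = 1 ∨ n % 6 = 4) → ∃ i j : ℕ,
      4 * (i : ℤ) = 5 * n ^ 2 - a6 n ∧
      (j : ℤ) = n ^ 2 ∧
      H (E6 a) n = (eps6 n : ℚ) * a ^ i * p ^ j) := by
  have h := torsionData_E6 hp ha0 hp0
  have h3 := h.two.symm
  simp only [psi6] at h3
  revert n
  refine forall_nat_of_add (N := 6) (by norm_num) ?_ ?_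
  · intro n hn
    interval_cases n
    · exact ⟨by simp, fun _ ↦ ⟨0, 0, rfl, rfl, by simp [H_zero, eps6]⟩⟩
    · exact ⟨fun _ ↦ H_one _, by simp⟩
    · exact ⟨by simp, fun _ ↦ ⟨5, 4, rfl, rfl,
      h.H_eq_of_mul_eq (by norm_num) (by simp only [psi6, eps6, h3]; push_cast; ring)⟩⟩
    · exact ⟨by simp, fun _ ↦ ⟨11, 9, rfl, rfl,
      h.H_eq_of_mul_eq (by norm_num) (by simp only [psi6, eps6, h3]; push_cast; ring)⟩⟩
    · exact ⟨fun _ ↦ h.H_eq_of_mul_eq (by norm_num) (by simp [psi6]), by simp⟩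
    · exact ⟨by simp, fun _ ↦ ⟨31, 25, rfl, rfl,
      h.H_eq_of_mul_eq (by norm_num) (by simp only [psi6, eps6, h3]; push_cast; ring)⟩⟩
  · rintro n ⟨hz, hv⟩
    simp only [Nat.add_mod_right]
    refine ⟨fun hn ↦ by rw [h.H_add, hz hn, mul_zero], fun hn ↦ ?_⟩
    obtain ⟨i, j, hi, hj, hH⟩ := hv hn
    refine ⟨i + 45 + 15 * n, j + 36 + 12 * n, ?_, ?_, ?_⟩
    · rw [show a6 (n + 6) = a6 n by simp [a6]]
      push_cast
      linarith
    · push_cast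
      linarith
    · rw [h.H_add, hH, eps6_add, show (-(a ^ 5 * p ^ 4)) ^ 3 = -1 * (a ^ 15 * p ^ 12) by ring]
      simp only [mul_pow, ← pow_mul, pow_add]
      push_cast
      ring

/-- Neither multiplier carries a minus sign, so the sign already has period 7. -/
theorem eps7_add (n : ℕ) : eps7 (n + 7) = eps7 n := by
  revert n
  refine forall_nat_of_add (N := 14) (by norm_num) (by decide) fun n hn ↦ ?_
  simpa [eps7, pow_add, add_right_comm n] using hn

theorem H_E7 {a p : ℚ} (hp : p = a - 1) (ha0 : a ≠ 0) (hp0 : p ≠ 0) (n : ℕ) :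
    ((n % 7 = 1 ∨ n % 7 = 5) → H (E7 a) n = 0) ∧
    (¬(n % 7 = 1 ∨ n % 7 = 5) → ∃ i j : ℕ,
      7 * (i : ℤ) = 15 * n ^ 2 - a7 n ∧
      7 * (j : ℤ) = 9 * n ^ 2 - b7 n ∧
      H (E7 a) n = (eps7 n : ℚ) * a ^ i * p ^ j) := by
  have h := torsionData_E7 hp ha0 hp0
  have h3 := h.two.symm
  simp only [psi7] at h3
  revert n
  refine forall_nat_of_add (N := 7) (by norm_num) ?_ ?_
  · intro n hn
    interval_cases n
    · exact ⟨by simp, fun _ ↦ ⟨0, 0, rfl, rfl, by simp [H_zero, eps7]⟩⟩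
    · exact ⟨fun _ ↦ H_one _, by simp⟩
    · exact ⟨by simp, fun _ ↦ ⟨9, 5, rfl, rfl,
      h.H_eq_of_mul_eq (by norm_num) (by simp only [psi7, eps7, h3]; push_cast; ring)⟩⟩
    · exact ⟨by simp, fun _ ↦ ⟨19, 11, rfl, rfl,
      h.H_eq_of_mul_eq (by norm_num) (by simp only [psi7, eps7, h3]; push_cast; ring)⟩⟩
    · exact ⟨by simp, fun _ ↦ ⟨35, 20, rfl, rfl,
      h.H_eq_of_mul_eq (by norm_num) (by simp only [psi7, eps7, h3]; push_cast; ring)⟩⟩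
    · exact ⟨fun _ ↦ h.H_eq_of_mul_eq (by norm_num) (by simp [psi7]), by simp⟩
    · exact ⟨by simp, fun _ ↦ ⟨77, 46, rfl, rfl,
      h.H_eq_of_mul_eq (by norm_num) (by simp only [psi7, eps7, h3]; push_cast; ring)⟩⟩
  · rintro n ⟨hz, hv⟩
    simp only [Nat.add_mod_right]
    refine ⟨fun hn ↦ by rw [h.H_add, hz hn, mul_zero], fun hn ↦ ?_⟩
    obtain ⟨i, j, hi, hj, hH⟩ := hv hn
    refine ⟨i + 105 + 30 * n, j + 63 + 18 * n, ?_, ?_, ?_⟩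
    · rw [show a7 (n + 7) = a7 n by simp [a7]]
      push_cast
      linarith
    · rw [show b7 (n + 7) = b7 n by simp [b7]]
      push_cast
      linarith
    · rw [h.H_add, hH, eps7_add, show (a ^ 10 * p ^ 6) ^ 3 = a ^ 30 * p ^ 18 by ring]
      simp only [mul_pow, ← pow_mul, pow_add]
      push_cast
      ring

theorem eps9_add (n : ℕ) : eps9 (n + 9) = -eps9 n := by
  revert n
  refine forall_nat_of_add (N := 18) (by norm_num) (by decide) fun n hn ↦ ?_
  simpa [eps9, pow_add, add_right_comm n] using hn

theorem H_E9 {a p e : ℚ} (hp : p = a - 1) (he : e = eta a) (ha0 : a ≠ 0) (hp0 : p ≠ 0) (he0 : e ≠ 0)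
    (n : ℕ) :
    ((n % 9 = 1 ∨ n % 9 = 7) → H (E9 a) n = 0) ∧
    (¬(n % 9 = 1 ∨ n % 9 = 7) → ∃ i j k : ℕ,
      3 * (i : ℤ) = 7 * n ^ 2 + a9 n ∧
      3 * (j : ℤ) = 4 * n ^ 2 - b9 n ∧
      (k : ℤ) = n ^ 2 + c9 n ∧
      H (E9 a) n = (eps9 n : ℚ) * a ^ i * p ^ j * e ^ k) := by
  have h := torsionData_E9 hp he ha0 hp0 he0
  have h3 := h.two.symm
  simp only [psi9] at h3
  revert n
  refine forall_nat_of_add (N := 9) (by norm_num) ?_ ?_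
  · intro n hn
    interval_cases n
    · exact ⟨by simp, fun _ ↦ ⟨0, 0, 0, rfl, rfl, rfl, by simp [H_zero, eps9]⟩⟩
    · exact ⟨fun _ ↦ H_one _, by simp⟩
    · exact ⟨by simp, fun _ ↦ ⟨10, 5, 4, rfl, rfl, rfl,
      h.H_eq_of_mul_eq (by norm_num) (by simp only [psi9, eps9, h3]; push_cast; ring)⟩⟩
    · exact ⟨by simp, fun _ ↦ ⟨21, 11, 9, rfl, rfl, rfl,
      h.H_eq_of_mul_eq (by norm_num) (by simp only [psi9, eps9, h3]; push_cast; ring)⟩⟩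
    · exact ⟨by simp, fun _ ↦ ⟨37, 20, 17, rfl, rfl, rfl,
      h.H_eq_of_mul_eq (by norm_num) (by simp only [psi9, eps9, h3]; push_cast; ring)⟩⟩
    · exact ⟨by simp, fun _ ↦ ⟨59, 32, 25, rfl, rfl, rfl,
      h.H_eq_of_mul_eq (by norm_num) (by simp only [psi9, eps9, h3]; push_cast; ring)⟩⟩
    · exact ⟨by simp, fun _ ↦ ⟨85, 47, 36, rfl, rfl, rfl,
      h.H_eq_of_mul_eq (by norm_num) (by simp only [psi9, eps9, h3]; push_cast; ring)⟩⟩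
    · exact ⟨fun _ ↦ h.H_eq_of_mul_eq (by norm_num) (by simp [psi9]), by simp⟩
    · exact ⟨by simp, fun _ ↦ ⟨149, 85, 64, rfl, rfl, rfl,
      h.H_eq_of_mul_eq (by norm_num) (by simp only [psi9, eps9, h3]; push_cast; ring)⟩⟩
  · rintro n ⟨hz, hv⟩
    simp only [Nat.add_mod_right]
    refine ⟨fun hn ↦ by rw [h.H_add, hz hn, mul_zero], fun hn ↦ ?_⟩
    obtain ⟨i, j, k, hi, hj, hk, hH⟩ := hv hn
    refine ⟨i + 189 + 42 * n, j + 108 + 24 * n, k + 81 + 18 * n, ?_, ?_, ?_, ?_⟩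
    · rw [show a9 (n + 9) = a9 n by simp [a9]]
      push_cast
      linarith
    · rw [show b9 (n + 9) = b9 n by simp [b9]]
      push_cast
      linarith
    · rw [show c9 (n + 9) = c9 n by simp [c9]]
      push_cast
      linarith
    · rw [h.H_add, hH, eps9_add, show (a ^ 14 * p ^ 8 * e ^ 6) ^ 3 = a ^ 42 * p ^ 24 * e ^ 18 by
        ring]
      simp only [mul_pow, ← pow_mul, pow_add]
      push_cast
      ring

theorem eps10_add (n : ℕ) : eps10 (n + 10) = ((-1) ^ n * eps10 n) := by
  revert n
  refine forall_nat_of_add (N := 20) (by norm_num) (by decide) fun n hn ↦ ?_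
  simpa [eps10, pow_add, add_right_comm n] using hn

theorem H_E10 {a p w z : ℚ} (hp : p = a - 1) (hw : w = 2 * a - 1) (hz : z = zeta a) (ha0 : a ≠ 0)
    (hp0 : p ≠ 0) (hw0 : w ≠ 0) (hz0 : z ≠ 0) (n : ℕ) :
    ((n % 10 = 1 ∨ n % 10 = 8) → H (E10 a) n = 0) ∧
    (¬(n % 10 = 1 ∨ n % 10 = 8) → ∃ i j k l : ℕ,
      20 * (i : ℤ) = 63 * n ^ 2 + a10 n ∧
      20 * (j : ℤ) = 27 * n ^ 2 - b10 n ∧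
      5 * (k : ℤ) = 6 * n ^ 2 + c10 n ∧
      4 * (l : ℤ) = 15 * n ^ 2 + d10 n ∧
      H (E10 a) n = (eps10 n : ℚ) * a ^ i * p ^ j * w ^ k * z ^ l) := by
  have h := torsionData_E10 hp hw hz ha0 hp0 hw0 hz0
  have h3 := h.two.symm
  simp only [psi10] at h3
  revert n
  refine forall_nat_of_add (N := 10) (by norm_num) ?_ ?_
  · intro n hn
    interval_cases n
    · exact ⟨by simp, fun _ ↦ ⟨0, 0, 0, 0, rfl, rfl, rfl, rfl, by simp [H_zero, eps10]⟩⟩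
    · exact ⟨fun _ ↦ H_one _, by simp⟩
    · exact ⟨by simp, fun _ ↦ ⟨13, 5, 5, 15, rfl, rfl, rfl, rfl,
      h.H_eq_of_mul_eq (by norm_num) (by simp only [psi10, eps10, h3]; push_cast; ring)⟩⟩
    · exact ⟨by simp, fun _ ↦ ⟨28, 11, 11, 34, rfl, rfl, rfl, rfl,
      h.H_eq_of_mul_eq (by norm_num) (by simp only [psi10, eps10, h3]; push_cast; ring)⟩⟩
    · exact ⟨by simp, fun _ ↦ ⟨52, 20, 19, 60, rfl, rfl, rfl, rfl,
      h.H_eq_of_mul_eq (by norm_num) (by simp only [psi10, eps10, h3]; push_cast; ring)⟩⟩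
    · exact ⟨by simp, fun _ ↦ ⟨80, 32, 30, 94, rfl, rfl, rfl, rfl,
      h.H_eq_of_mul_eq (by norm_num) (by simp only [psi10, eps10, h3]; push_cast; ring)⟩⟩
    · exact ⟨by simp, fun _ ↦ ⟨113, 47, 44, 135, rfl, rfl, rfl, rfl,
      h.H_eq_of_mul_eq (by norm_num) (by simp only [psi10, eps10, h3]; push_cast; ring)⟩⟩
    · exact ⟨by simp, fun _ ↦ ⟨155, 65, 59, 184, rfl, rfl, rfl, rfl,
      h.H_eq_of_mul_eq (by norm_num) (by simp only [psi10, eps10, h3]; push_cast; ring)⟩⟩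
    · exact ⟨fun _ ↦ h.H_eq_of_mul_eq (by norm_num) (by simp [psi10]), by simp⟩
    · exact ⟨by simp, fun _ ↦ ⟨255, 109, 97, 304, rfl, rfl, rfl, rfl,
      h.H_eq_of_mul_eq (by norm_num) (by simp only [psi10, eps10, h3]; push_cast; ring)⟩⟩
  · rintro n ⟨hz, hv⟩
    simp only [Nat.add_mod_right]
    refine ⟨fun hn ↦ by rw [h.H_add, hz hn, mul_zero], fun hn ↦ ?_⟩
    obtain ⟨i, j, k, l, hi, hj, hk, hl, hH⟩ := hv hn
    -- Each constant term is read off u³ and each coefficient of n off v³.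
    refine ⟨i + 315 + 63 * n, j + 135 + 27 * n, k + 120 + 24 * n, l + 375 + 75 * n, ?_, ?_, ?_, ?_,
      ?_⟩
    · rw [show a10 (n + 10) = a10 n by simp [a10]]
      push_cast
      linarith
    · rw [show b10 (n + 10) = b10 n by simp [b10]]
      push_cast
      linarith
    · rw [show c10 (n + 10) = c10 n by simp [c10]]
      push_cast
      linarith
    · rw [show d10 (n + 10) = d10 n by simp [d10]]
      push_cast
      linarith
    · rw [h.H_add, hH, eps10_add, show (-(a ^ 21 * p ^ 9 * w ^ 8 * z ^ 25)) ^ 3 = -1 * (a ^ 63 *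
        p ^ 27 * w ^ 24 * z ^ 75) by ring]
      simp only [mul_pow, ← pow_mul, pow_add]
      push_cast
      ring

theorem eps12_add (n : ℕ) : eps12 (n + 12) = -eps12 n := by
  revert n
  refine forall_nat_of_add (N := 24) (by norm_num) (by decide) fun n hn ↦ ?_
  simpa [eps12, pow_add, add_right_comm n] using hn

theorem H_E12 {a p w l t : ℚ} (hp : p = a - 1) (hw : w = 2 * a - 1) (hl : l = lam a) (ht : t = theta
    a) (ha0 : a ≠ 0) (hp0 : p ≠ 0) (hw0 : w ≠ 0) (hl0 : l ≠ 0) (ht0 : t ≠ 0) (n : ℕ) :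
    ((n % 12 = 1 ∨ n % 12 = 10) → H (E12 a) n = 0) ∧
    (¬(n % 12 = 1 ∨ n % 12 = 10) → ∃ i j k q m : ℕ,
      4 * (i : ℤ) = n ^ 2 - a12 n ∧
      8 * (j : ℤ) = 59 * n ^ 2 + b12 n ∧
      8 * (k : ℤ) = n ^ 2 - c12 n ∧
      8 * (q : ℤ) = 9 * n ^ 2 - d12 n ∧
      (m : ℤ) = n ^ 2 + e12 n ∧
      H (E12 a) n = (eps12 n : ℚ) * a ^ i * p ^ j * w ^ k * l ^ q * t ^ m) := by
  have h := torsionData_E12 hp hw hl ht ha0 hp0 hw0 hl0 ht0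
  have h3 := h.two.symm
  simp only [psi12] at h3
  revert n
  refine forall_nat_of_add (N := 12) (by norm_num) ?_ ?_
  · intro n hn
    interval_cases n
    · exact ⟨by simp, fun _ ↦ ⟨0, 0, 0, 0, 0, rfl, rfl, rfl, rfl, rfl, by simp [H_zero, eps12]⟩⟩
    · exact ⟨fun _ ↦ H_one _, by simp⟩
    · exact ⟨by simp, fun _ ↦ ⟨0, 29, 0, 5, 4, rfl, rfl, rfl, rfl, rfl,
      h.H_eq_of_mul_eq (by norm_num) (by simp only [psi12, eps12, h3]; push_cast; ring)⟩⟩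
    · exact ⟨by simp, fun _ ↦ ⟨1, 68, 1, 10, 9, rfl, rfl, rfl, rfl, rfl,
      h.H_eq_of_mul_eq (by norm_num) (by simp only [psi12, eps12, h3]; push_cast; ring)⟩⟩
    · exact ⟨by simp, fun _ ↦ ⟨2, 118, 2, 18, 17, rfl, rfl, rfl, rfl, rfl,
      h.H_eq_of_mul_eq (by norm_num) (by simp only [psi12, eps12, h3]; push_cast; ring)⟩⟩
    · exact ⟨by simp, fun _ ↦ ⟨3, 185, 2, 29, 25, rfl, rfl, rfl, rfl, rfl,
      h.H_eq_of_mul_eq (by norm_num) (by simp only [psi12, eps12, h3]; push_cast; ring)⟩⟩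
    · exact ⟨by simp, fun _ ↦ ⟨6, 267, 4, 41, 36, rfl, rfl, rfl, rfl, rfl,
      h.H_eq_of_mul_eq (by norm_num) (by simp only [psi12, eps12, h3]; push_cast; ring)⟩⟩
    · exact ⟨by simp, fun _ ↦ ⟨10, 361, 7, 55, 50, rfl, rfl, rfl, rfl, rfl,
      h.H_eq_of_mul_eq (by norm_num) (by simp only [psi12, eps12, h3]; push_cast; ring)⟩⟩
    · exact ⟨by simp, fun _ ↦ ⟨14, 474, 8, 72, 64, rfl, rfl, rfl, rfl, rfl,
      h.H_eq_of_mul_eq (by norm_num) (by simp only [psi12, eps12, h3]; push_cast; ring)⟩⟩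
    · exact ⟨by simp, fun _ ↦ ⟨18, 597, 9, 92, 81, rfl, rfl, rfl, rfl, rfl,
      h.H_eq_of_mul_eq (by norm_num) (by simp only [psi12, eps12, h3]; push_cast; ring)⟩⟩
    · exact ⟨fun _ ↦ h.H_eq_of_mul_eq (by norm_num) (by simp [psi12]), by simp⟩
    · exact ⟨by simp, fun _ ↦ ⟨30, 893, 15, 136, 121, rfl, rfl, rfl, rfl, rfl,
      h.H_eq_of_mul_eq (by norm_num) (by simp only [psi12, eps12, h3]; push_cast; ring)⟩⟩
  · rintro n ⟨hz, hv⟩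
    simp only [Nat.add_mod_right]
    refine ⟨fun hn ↦ by rw [h.H_add, hz hn, mul_zero], fun hn ↦ ?_⟩
    obtain ⟨i, j, k, q, m, hi, hj, hk, hq, hm, hH⟩ := hv hn
    refine ⟨i + 36 + 6 * n, j + 1062 + 177 * n, k + 18 + 3 * n, q + 162 + 27 * n, m + 144 + 24 * n,
      ?_, ?_, ?_, ?_, ?_, ?_⟩
    · rw [show a12 (n + 12) = a12 n by simp [a12]]
      push_cast
      linarith
    · rw [show b12 (n + 12) = b12 n by simp [b12]]
      push_cast
      linarith
    · rw [show c12 (n + 12) = c12 n by simp [c12]]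
      push_cast
      linarith
    · rw [show d12 (n + 12) = d12 n by simp [d12]]
      push_cast
      linarith
    · rw [show e12 (n + 12) = e12 n by simp [e12]]
      push_cast
      linarith
    · rw [h.H_add, hH, eps12_add, show (a ^ 2 * p ^ 59 * w * l ^ 9 * t ^ 8) ^ 3 = a ^ 6 * p ^ 177 *
        w ^ 3 * l ^ 27 * t ^ 24 by ring]
      simp only [mul_pow, ← pow_mul, pow_add]
      push_cast
      ring

/-! ### Non-vanishing of the factors, and the conclusion. -/

theorem eta_ne_zero (a : ℚ) : eta a ≠ 0 := by
  have : 0 < eta a := by rw [eta]; nlinarith [sq_nonneg (2 * a - 1)]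
  exact this.ne'

theorem theta_ne_zero (a : ℚ) : theta a ≠ 0 := by
  have : theta a < 0 := by rw [theta]; nlinarith [sq_nonneg (2 * a - 1)]
  exact this.ne

theorem two_mul_sub_one_ne_zero (α : ℤ) : 2 * (α : ℚ) - 1 ≠ 0 := by
  have : 2 * α - 1 ≠ 0 := by omega
  exact_mod_cast this

/-- For integral α the value -α(α - 1) + 2α - 1 is odd, since α(α - 1) is even. -/
theorem zeta_ne_zero (α : ℤ) : zeta α ≠ 0 := by
  have : -α ^ 2 + 3 * α - 1 ≠ 0 := by
    obtain ⟨k, hk⟩ := Int.even_mul_pred_self α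
    intro h
    have : α * (α - 1) = α ^ 2 - α := by ring
    omega
  rw [zeta]
  exact_mod_cast this

/-- The quadratic factor has negative discriminant; the other one is -α(2α - 1), nonzero for an
integer α ≠ 0. -/
theorem lam_ne_zero {α : ℤ} (h : α ≠ 0) : lam α ≠ 0 := by
  have h1 : (0 : ℚ) < 3 * α ^ 2 - 3 * α + 1 := by nlinarith [sq_nonneg (2 * (α : ℚ) - 1)]
  have h2 : (α : ℚ) - 2 * α ^ 2 = -(α * (2 * α - 1)) := by ring
  rw [lam, h2]
  exact mul_ne_zero h1.ne' (neg_ne_zero.2 (mul_ne_zero (Int.cast_ne_zero.2 h)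
    (two_mul_sub_one_ne_zero α)))

end TateNormalForm

theorem theoremA2 :
    (∀ α : ℤ, α ≠ 0 → ∀ n : ℕ,
      ((n % 4 = 1 ∨ n % 4 = 2) → TateNormalForm.H (TateNormalForm.E4 α) n = 0) ∧
      (¬(n % 4 = 1 ∨ n % 4 = 2) → ∃ i : ℕ,
        8 * (i : ℤ) = 9 * n ^ 2 - TateNormalForm.a4 n ∧
        TateNormalForm.H (TateNormalForm.E4 α) n =
          (TateNormalForm.eps4 n : ℚ) * (α : ℚ) ^ i)) ∧
    (∀ α : ℤ, α ≠ 0 → ∀ n : ℕ,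
      ((n % 5 = 1 ∨ n % 5 = 3) → TateNormalForm.H (TateNormalForm.E5 α) n = 0) ∧
      (¬(n % 5 = 1 ∨ n % 5 = 3) → ∃ i : ℕ,
        5 * (i : ℤ) = 6 * n ^ 2 - TateNormalForm.a5 n ∧
        TateNormalForm.H (TateNormalForm.E5 α) n =
          (TateNormalForm.eps5 n : ℚ) * (α : ℚ) ^ i)) ∧
    (∀ α : ℤ, α ≠ -1 → α ≠ 0 → ∀ n : ℕ,
      ((n % 6 = 1 ∨ n % 6 = 4) → TateNormalForm.H (TateNormalForm.E6 α) n = 0) ∧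
      (¬(n % 6 = 1 ∨ n % 6 = 4) → ∃ i j : ℕ,
        4 * (i : ℤ) = 5 * n ^ 2 - TateNormalForm.a6 n ∧
        (j : ℤ) = n ^ 2 ∧
        TateNormalForm.H (TateNormalForm.E6 α) n =
          (TateNormalForm.eps6 n : ℚ) * (α : ℚ) ^ i * ((α : ℚ) + 1) ^ j)) ∧
    (∀ α : ℤ, α ≠ 0 → α ≠ 1 → ∀ n : ℕ,
      ((n % 7 = 1 ∨ n % 7 = 5) → TateNormalForm.H (TateNormalForm.E7 α) n = 0) ∧
      (¬(n % 7 = 1 ∨ n % 7 = 5) → ∃ i j : ℕ,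
        7 * (i : ℤ) = 15 * n ^ 2 - TateNormalForm.a7 n ∧
        7 * (j : ℤ) = 9 * n ^ 2 - TateNormalForm.b7 n ∧
        TateNormalForm.H (TateNormalForm.E7 α) n =
          (TateNormalForm.eps7 n : ℚ) * (α : ℚ) ^ i * ((α : ℚ) - 1) ^ j)) ∧
    (∀ α : ℤ, α ≠ 0 → α ≠ 1 → ∀ n : ℕ,
      ((n % 9 = 1 ∨ n % 9 = 7) → TateNormalForm.H (TateNormalForm.E9 α) n = 0) ∧
      (¬(n % 9 = 1 ∨ n % 9 = 7) → ∃ i j k : ℕ,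
        3 * (i : ℤ) = 7 * n ^ 2 + TateNormalForm.a9 n ∧
        3 * (j : ℤ) = 4 * n ^ 2 - TateNormalForm.b9 n ∧
        (k : ℤ) = n ^ 2 + TateNormalForm.c9 n ∧
        TateNormalForm.H (TateNormalForm.E9 α) n =
          (TateNormalForm.eps9 n : ℚ) *
            (α : ℚ) ^ i * ((α : ℚ) - 1) ^ j * TateNormalForm.eta α ^ k)) ∧
    (∀ α : ℤ, α ≠ 0 → α ≠ 1 → ∀ n : ℕ,
      ((n % 10 = 1 ∨ n % 10 = 8) → TateNormalForm.H (TateNormalForm.E10 α) n = 0) ∧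
      (¬(n % 10 = 1 ∨ n % 10 = 8) → ∃ i j k l : ℕ,
        20 * (i : ℤ) = 63 * n ^ 2 + TateNormalForm.a10 n ∧
        20 * (j : ℤ) = 27 * n ^ 2 - TateNormalForm.b10 n ∧
        5 * (k : ℤ) = 6 * n ^ 2 + TateNormalForm.c10 n ∧
        4 * (l : ℤ) = 15 * n ^ 2 + TateNormalForm.d10 n ∧
        TateNormalForm.H (TateNormalForm.E10 α) n =
          (TateNormalForm.eps10 n : ℚ) *
            (α : ℚ) ^ i * ((α : ℚ) - 1) ^ j *
            (2 * (α : ℚ) - 1) ^ k * TateNormalForm.zeta α ^ l)) ∧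
    (∀ α : ℤ, α ≠ 0 → α ≠ 1 → ∀ n : ℕ,
      ((n % 12 = 1 ∨ n % 12 = 10) → TateNormalForm.H (TateNormalForm.E12 α) n = 0) ∧
      (¬(n % 12 = 1 ∨ n % 12 = 10) → ∃ i j k l m : ℕ,
        4 * (i : ℤ) = n ^ 2 - TateNormalForm.a12 n ∧
        8 * (j : ℤ) = 59 * n ^ 2 + TateNormalForm.b12 n ∧
        8 * (k : ℤ) = n ^ 2 - TateNormalForm.c12 n ∧
        8 * (l : ℤ) = 9 * n ^ 2 - TateNormalForm.d12 n ∧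
        (m : ℤ) = n ^ 2 + TateNormalForm.e12 n ∧
        TateNormalForm.H (TateNormalForm.E12 α) n =
          (TateNormalForm.eps12 n : ℚ) *
            (α : ℚ) ^ i * ((α : ℚ) - 1) ^ j *
            (2 * (α : ℚ) - 1) ^ k * TateNormalForm.lam α ^ l * TateNormalForm.theta α ^ m)) := by
  refine ⟨fun α h0 n ↦ ?_, fun α h0 n ↦ ?_, fun α h1 h0 n ↦ ?_, fun α h0 h1 n ↦ ?_,
    fun α h0 h1 n ↦ ?_, fun α h0 h1 n ↦ ?_, fun α h0 h1 n ↦ ?_⟩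
  · exact TateNormalForm.H_E4 (Int.cast_ne_zero.2 h0) n
  · exact TateNormalForm.H_E5 (Int.cast_ne_zero.2 h0) n
  · exact TateNormalForm.H_E6 rfl (Int.cast_ne_zero.2 h0)
      (by exact_mod_cast fun h ↦ h1 (by omega)) n
  all_goals
    have ha : (α : ℚ) ≠ 0 := Int.cast_ne_zero.2 h0
    have hp : (α : ℚ) - 1 ≠ 0 := sub_ne_zero.2 (by exact_mod_cast h1)
  · exact TateNormalForm.H_E7 rfl ha hp n
  · exact TateNormalForm.H_E9 rfl rfl ha hp (TateNormalForm.eta_ne_zero _) n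
  · exact TateNormalForm.H_E10 rfl rfl rfl ha hp (TateNormalForm.two_mul_sub_one_ne_zero α)
      (TateNormalForm.zeta_ne_zero α) n
  · exact TateNormalForm.H_E12 rfl rfl rfl rfl ha hp (TateNormalForm.two_mul_sub_one_ne_zero α)
      (TateNormalForm.lam_ne_zero h0) (TateNormalForm.theta_ne_zero _) n
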